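/- Let $\mathbb{F}_q$ be a finite field of odd cardinality $q$. For a monic irreducible $P\in\mathbb{F}_q[t]$ let $\left(\frac{f}{P}\right)$ be the quadratic residue symbol ($0$ if $P\mid f$, $1$ if $P\nmid f$ and $f$ is a square modulo $P$, $-1$ otherwise). For monic $D$ let $\chi_D(f)=\left(\frac{f}{D}\right)=\prod_{P}\left(\frac{f}{P}\right)$, the product over the monic irreducible factors $P$ of $D$, with multiplicity. Let $\mathcal{H}_n$ be the set of monic square-free polynomials of degree $n$ in $\mathbb{F}_q[t]$, and write $|f|=q^{\deg f}$ for $f\neq 0$. Let $\varepsilon>0$. There is a constant $K=K(\varepsilon)$, depending only on $\varepsilon$, such that for every odd $q$, every $n\ge 0$ and every $\ell=\ell_1\ell_2^2\in\mathbb{F}_q[t]$ with $\ell_1$ square-free which is not a constant multiple of a square (for monic $\ell$: which is not a square), $$\Big|\sum_{D\in\mathcal{H}_n}\chi_D(\ell)\Big|\le K\,q^{(1/2+\varepsilon)n}\exp\!\left((\deg \ell_1)^{1-\varepsilon}\right)\prod_{P\mid \ell_2}\left(1+|P|^{-1/2-\varepsilon}\right),$$ where $P$ runs over the monic irreducible divisors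 of $\ell_2$. -/

import Mathlib

open Polynomial

universe u

namespace FunctionFieldCharSum

/-- There are only finitely many monic square-free polynomials of degree `n` over a finite field. -/
theorem finite_hyperelliptic (F : Type u) [Field F] [Fintype F] (n : ℕ) :
    {D : F[X] | D.Monic ∧ Squarefree D ∧ D.natDegree = n}.Finite := by
  have hfin : Finite (Polynomial.degreeLT F (n + 1)) :=
    Finite.of_equiv _ (Polynomial.degreeLTEquiv F (n + 1)).symm.toEquiv
  refine Set.Finite.subset (Set.toFinite (Polynomial.degreeLT F (n + 1) : Set F[X])) ?_
  rintro D ⟨-, -, hn⟩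
  rw [SetLike.mem_coe, Polynomial.mem_degreeLT]
  refine lt_of_le_of_lt Polynomial.degree_le_natDegree ?_
  rw [hn]
  exact_mod_cast Nat.lt_succ_self n

/-- The hyperelliptic ensemble `H_n`: the monic square-free polynomials of degree `n`. -/
noncomputable def hyperelliptic (F : Type u) [Field F] [Fintype F] (n : ℕ) : Finset F[X] :=
  (finite_hyperelliptic F n).toFinset

open Classical in
/-- The quadratic residue symbol `(f / P)` for a monic irreducible polynomial `P`. -/
noncomputable def residueSymbol {F : Type u} [Field F] (f P : F[X]) : ℤ :=
  if P ∣ f then 0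
  else if ∃ g : F[X], P ∣ f - g ^ 2 then 1
  else -1

open Classical in
/-- The quadratic character `χ_D(f) = (f / D)`: the product of the symbols `(f / P)` over the monic
irreducible factors `P` of `D`, counted with multiplicity. -/
noncomputable def chi {F : Type u} [Field F] (D f : F[X]) : ℤ :=
  ((UniqueFactorizationMonoid.normalizedFactors D).map fun P => residueSymbol f P).prod

open Classical in
/-- The finite set of monic irreducible polynomials dividing `f` (for `f ≠ 0`). -/
noncomputable def primeDivisors {F : Type u} [Field F] (f : F[X]) : Finset F[X] :=
  (UniqueFactorizationMonoid.normalizedFactors f).toFinset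

open Classical in
/-- The norm `|f| = q ^ deg f` of a nonzero polynomial, and `|0| = 0`. -/
noncomputable def polyNorm {F : Type u} [Field F] [Fintype F] (f : F[X]) : ℝ :=
  if f = 0 then 0 else (Fintype.card F : ℝ) ^ f.natDegree

end FunctionFieldCharSum

/-!
Write `d = deg ℓ₁` and let `a n` be the sum of `χ_D(ℓ)` over `D ∈ H_n`. The generating function of
`a` is the Euler product `∏ (1 + (ℓ/P) u ^ deg P)`, and its logarithmic derivative gives the
recursion `n a n = ∑_{1 ≤ k ≤ n} T k a (n - k)` with
`T k = -∑_{j ∣ k} j ∑_{deg P = j} (-(ℓ/P)) ^ (k / j)` (`natCast_mul_charSum`). If `|T k| ≤ t k`,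
such a recursion forces `|a n| r ^ n ≤ exp (∑_{k ≤ n} t k r ^ k / k)` for every `r ≥ 0`
(`abs_mul_pow_le_exp_of_recursion`); this replaces a contour integral, and it is used with
`r = q ^ (-1/2-ε)`.

Grouping the elements `x` of the extension `K` of degree `k` of the ground field by their minimal
polynomial, `T k` is the character sum `S k = ∑_{x ∈ K} χ_K(ℓ₁(x))` up to two errors: the `x` whose
minimal polynomial divides `ℓ₂`, and the `x` with `k / deg x` even, which lie in the subfield with
`q ^ (k / 2)` elements (`abs_primePowerSum_sub_le`). The second error contributes `O(1)` to the
exponent, the first one the product over `P ∣ ℓ₂` together with a factor bounded by a convergent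
`∏ (1 - |P| ^ (-1-2ε))⁻¹`.

The arithmetic input is Weil's bound `|S k| ≤ 8 d q ^ (k / 2)` (`abs_sum_quadraticChar_le`), proved
by Stepanov's method: with `g = f ^ ((q - 1) / 2)`, linear algebra yields a nonzero polynomial
`f ^ M ∑ (r_j + s_j g) X ^ (q j)` of small degree that vanishes to order `M` wherever `g = a`, so
that the number of these points is at most `q / 2 + O(d √q)`. Since it is linear in `d`,
interpolating it with the trivial bound `|S k| ≤ q ^ k` gives
`∑ |S k| r ^ k / k ≪ d ^ (1 - 3ε/2)`, which is at most `d ^ (1 - ε) + O(1)`. For `ε ≥ 1/2` the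
trivial bound `|H_n| ≤ q ^ n` suffices.
-/

universe v

namespace FunctionFieldCharSum

/-! ### Stepanov's method for the quadratic character -/

section Stepanov

variable {E : Type u} [Field E]

/-- A Hasse derivative of order `k` lowers the exponent of a power by at most `k`. -/
theorem exists_hasseDeriv_pow (f : E[X]) (e k : ℕ) (hk : k ≤ e) :
    ∃ φ : E[X], hasseDeriv k (f ^ e) = f ^ (e - k) * φ ∧ φ.natDegree ≤ k * f.natDegree := by
  induction e generalizing k with
  | zero =>
    obtain rfl : k = 0 := by omega
    exact ⟨1, by simp, by simp⟩
  | succ e ih =>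
    rcases Nat.lt_or_ge e k with h | h
    · obtain rfl : k = e + 1 := by omega
      refine ⟨hasseDeriv (e + 1) (f ^ (e + 1)), by simp, ?_⟩
      refine (natDegree_hasseDeriv_le _ _).trans ((Nat.sub_le _ _).trans natDegree_pow_le)
    · have key : ∀ ij ∈ Finset.HasAntidiagonal.antidiagonal k, ∃ ψ : E[X],
          hasseDeriv ij.1 (f ^ e) * hasseDeriv ij.2 f = f ^ (e + 1 - k) * ψ ∧
            ψ.natDegree ≤ k * f.natDegree := by
        rintro ⟨i, j⟩ hij
        rw [Finset.HasAntidiagonal.mem_antidiagonal] at hij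
        simp only at hij ⊢
        obtain ⟨φ, h1, h2⟩ := ih i (by omega)
        rcases j with _ | j
        · obtain rfl : i = k := by omega
          refine ⟨φ, ?_, h2⟩
          rw [h1, show e + 1 - i = (e - i) + 1 by omega]
          simp only [hasseDeriv_zero, LinearMap.id_coe, id_eq]
          ring
        · refine ⟨f ^ j * φ * hasseDeriv (j + 1) f, ?_, ?_⟩
          · rw [h1, show e - i = (e + 1 - k) + j by omega, pow_add]
            ring
          · have h3 : (hasseDeriv (j + 1) f).natDegree ≤ f.natDegree :=
              (natDegree_hasseDeriv_le _ _).trans (Nat.sub_le _ _)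
            have h4 : (f ^ j).natDegree ≤ j * f.natDegree := natDegree_pow_le
            calc _ ≤ (j * f.natDegree + i * f.natDegree) + f.natDegree :=
                  natDegree_mul_le_of_le (natDegree_mul_le_of_le h4 h2) h3
              _ = k * f.natDegree := by rw [← hij]; ring
      choose! ψ hψ using key
      refine ⟨∑ ij ∈ Finset.HasAntidiagonal.antidiagonal k, ψ ij, ?_, ?_⟩
      · rw [pow_succ, hasseDeriv_mul, Finset.mul_sum]
        exact Finset.sum_congr rfl fun ij hij => (hψ ij hij).1
      · exact natDegree_sum_le_of_forall_le _ _ fun ij hij => (hψ ij hij).2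

/-- The cofactor `D r` is linear in `r`, so that its vanishing is a system of linear equations for
the coefficients of `r`. -/
theorem exists_hasseDeriv_pow_mul (f : E[X]) (e k : ℕ) (hk : k ≤ e) :
    ∃ D : E[X] →ₗ[E] E[X], (∀ r, hasseDeriv k (f ^ e * r) = f ^ (e - k) * D r) ∧
      ∀ r, (D r).natDegree ≤ k * f.natDegree + r.natDegree := by
  have h : ∀ i, ∃ φ : E[X], i ≤ e →
      (hasseDeriv i (f ^ e) = f ^ (e - i) * φ ∧ φ.natDegree ≤ i * f.natDegree) := by
    intro i
    by_cases hi : i ≤ e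
    · obtain ⟨φ, hφ⟩ := exists_hasseDeriv_pow f e i hi
      exact ⟨φ, fun _ => hφ⟩
    · exact ⟨0, fun h => absurd h hi⟩
  choose φ hφ using h
  refine ⟨∑ ij ∈ Finset.HasAntidiagonal.antidiagonal k,
    (LinearMap.mulLeft E (f ^ ij.2 * φ ij.1)) ∘ₗ hasseDeriv ij.2, fun r => ?_, fun r => ?_⟩
  · rw [hasseDeriv_mul, LinearMap.sum_apply, Finset.mul_sum]
    refine Finset.sum_congr rfl ?_
    rintro ⟨i, j⟩ hij
    rw [Finset.HasAntidiagonal.mem_antidiagonal] at hij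
    simp only at hij
    simp only [LinearMap.comp_apply, LinearMap.mulLeft_apply]
    rw [(hφ i (by omega)).1, show e - i = (e - k) + j by omega, pow_add]
    ring
  · rw [LinearMap.sum_apply]
    refine natDegree_sum_le_of_forall_le _ _ ?_
    rintro ⟨i, j⟩ hij
    rw [Finset.HasAntidiagonal.mem_antidiagonal] at hij
    simp only at hij
    simp only [LinearMap.comp_apply, LinearMap.mulLeft_apply]
    have h3 : (hasseDeriv j r).natDegree ≤ r.natDegree :=
      (natDegree_hasseDeriv_le _ _).trans (Nat.sub_le _ _)
    have h4 : (f ^ j).natDegree ≤ j * f.natDegree := natDegree_pow_le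
    calc _ ≤ (j * f.natDegree + i * f.natDegree) + r.natDegree :=
          natDegree_mul_le_of_le (natDegree_mul_le_of_le h4 (hφ i (by omega)).2) h3
      _ = _ := by rw [← hij]; ring

/-- A nonconstant squarefree polynomial is not a constant times a square of a rational function;
the proof is a descent on the degree of `r`. -/
theorem eq_zero_of_sq_mul_eq (f : E[X]) (hf : Squarefree f) (hd : 0 < f.natDegree) (b : E)
    (hb : b ≠ 0) (r s : E[X]) (h : r ^ 2 * f = C b * s ^ 2) : r = 0 := by
  by_contra hr
  induction hn : r.natDegree using Nat.strong_induction_on generalizing r s with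
  | _ n ih =>
  have hf0 : f ≠ 0 := hf.ne_zero
  have hs : f ∣ s := by
    refine (hf.dvd_pow_iff_dvd two_ne_zero).1 ?_
    have : f ∣ C b * s ^ 2 := ⟨r ^ 2, by rw [← h]; ring⟩
    exact (isUnit_C.2 hb.isUnit).dvd_mul_left.1 this
  obtain ⟨t, rfl⟩ := hs
  have h2 : r ^ 2 = C b * (f * t ^ 2) := mul_right_cancel₀ hf0 (by rw [h]; ring)
  have hrf : f ∣ r := by
    refine (hf.dvd_pow_iff_dvd two_ne_zero).1 ⟨C b * t ^ 2, by rw [h2]; ring⟩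
  obtain ⟨r', rfl⟩ := hrf
  have hr' : r' ≠ 0 := right_ne_zero_of_mul hr
  refine ih r'.natDegree ?_ r' t ?_ hr' rfl
  · rw [← hn, natDegree_mul hf0 hr']
    omega
  · refine mul_right_cancel₀ hf0 ?_
    calc r' ^ 2 * f * f = (f * r') ^ 2 := by ring
      _ = _ := by rw [h2]; ring

/-- There are `2 * J * c` unknown coefficients; the hypothesis `hcount` says that they outnumber the
equations. In the application, `D k` and `D' k` are the cofactors of the `k`-th Hasse derivatives
of `f ^ M * r` and `f ^ (M + (q - 1) / 2) * r`. -/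
theorem exists_stepanov_coeffs (m M c J : ℕ) (a : E) (D D' : ℕ → E[X] →ₗ[E] E[X])
    (hD : ∀ k < M, ∀ r, (D k r).natDegree ≤ k * m + r.natDegree)
    (hD' : ∀ k < M, ∀ r, (D' k r).natDegree ≤ k * m + r.natDegree)
    (hc : 0 < c) (hcount : ∑ k ∈ Finset.range M, (k * m + c + J) < 2 * J * c) :
    ∃ r s : Fin J → E[X], (∀ j, (r j).natDegree < c) ∧ (∀ j, (s j).natDegree < c) ∧
      ¬ (r = 0 ∧ s = 0) ∧
      ∀ k < M, ∑ j : Fin J, X ^ (j : ℕ) * (D k (r j) + C a * D' k (s j)) = 0 := by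
  classical
  let V := (Fin J → degreeLT E c) × (Fin J → degreeLT E c)
  let pr : Fin J → V →ₗ[E] E[X] := fun j =>
    (degreeLT E c).subtype ∘ₗ LinearMap.proj j ∘ₗ LinearMap.fst E _ _
  let ps : Fin J → V →ₗ[E] E[X] := fun j =>
    (degreeLT E c).subtype ∘ₗ LinearMap.proj j ∘ₗ LinearMap.snd E _ _
  let G : ℕ → V →ₗ[E] E[X] := fun k => ∑ j : Fin J, (LinearMap.mulLeft E (X ^ (j : ℕ))) ∘ₗ
    (D k ∘ₗ pr j + LinearMap.mulLeft E (C a) ∘ₗ D' k ∘ₗ ps j)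
  have hG : ∀ k v, G k v = ∑ j : Fin J, X ^ (j : ℕ) *
      (D k (v.1 j : E[X]) + C a * D' k (v.2 j : E[X])) := by
    intro k v
    simp [G, pr, ps]
    rfl
  let I := Σ k : Fin M, Fin (k * m + c + J)
  let L : V →ₗ[E] (I → E) := LinearMap.pi fun i => lcoeff E (i.2 : ℕ) ∘ₗ G i.1
  have hfin : Module.finrank E (degreeLT E c) = c := by
    rw [(degreeLTEquiv E c).finrank_eq, Module.finrank_fin_fun]
  have : Module.Finite E (degreeLT E c) := Module.Finite.equiv (degreeLTEquiv E c).symm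
  have hV : Module.finrank E V = 2 * J * c := by
    rw [Module.finrank_prod, Module.finrank_pi_fintype]
    simp only [hfin, Finset.sum_const, Finset.card_univ, Fintype.card_fin, smul_eq_mul]
    ring
  have hI : Module.finrank E (I → E) = ∑ k ∈ Finset.range M, (k * m + c + J) := by
    rw [Module.finrank_fintype_fun_eq_card, Fintype.card_sigma]
    simp only [Fintype.card_fin]
    exact Fin.sum_univ_eq_sum_range (fun k => k * m + c + J) M
  have hker : LinearMap.ker L ≠ ⊥ := L.ker_ne_bot_of_finrank_lt (by rw [hV, hI]; exact hcount)
  obtain ⟨v, hv, hv0⟩ := Submodule.exists_mem_ne_zero_of_ne_bot hker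
  have hdeg : ∀ p : degreeLT E c, (p : E[X]).natDegree < c := by
    rintro ⟨p, hp⟩
    rw [mem_degreeLT] at hp
    by_cases h0 : p = 0
    · subst h0; simpa using hc
    · exact (natDegree_lt_iff_degree_lt h0).2 hp
  refine ⟨fun j => v.1 j, fun j => v.2 j, fun j => hdeg _, fun j => hdeg _, ?_, ?_⟩
  · rintro ⟨h1, h2⟩
    refine hv0 (Prod.ext ?_ ?_)
    · funext j; exact Subtype.ext (congrFun h1 j)
    · funext j; exact Subtype.ext (congrFun h2 j)
  · intro k hk
    rw [← hG]
    ext i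
    rw [coeff_zero]
    by_cases hi : i < k * m + c + J
    · have := congrFun (LinearMap.mem_ker.1 hv) ⟨⟨k, hk⟩, ⟨i, hi⟩⟩
      simpa [L] using this
    · refine coeff_eq_zero_of_natDegree_lt (lt_of_le_of_lt ?_ (lt_of_lt_of_le
        (show k * m + c + J - 1 < k * m + c + J by omega) (not_lt.1 hi)))
      rw [hG]
      refine natDegree_sum_le_of_forall_le _ _ fun j _ => ?_
      have h1 := hD k hk (v.1 j)
      have h2 := hD' k hk (v.2 j)
      have h3 := hdeg (v.1 j)
      have h4 := hdeg (v.2 j)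
      have h5 : (D k (v.1 j) + C a * D' k (v.2 j) : E[X]).natDegree ≤ k * m + c :=
        (natDegree_add_le _ _).trans (max_le (by omega)
          ((natDegree_C_mul_le _ _).trans (by omega)))
      have h6 := natDegree_mul_le_of_le (natDegree_X_pow_le (R := E) (j : ℕ)) h5
      have := j.2
      omega

theorem X_sub_C_pow_dvd_of_hasseDeriv (x : E) (M : ℕ) (p : E[X])
    (h : ∀ k < M, (hasseDeriv k p).eval x = 0) : (X - C x) ^ M ∣ p := by
  rw [X_sub_C_pow_dvd_iff, X_pow_dvd_iff]
  intro k hk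
  rw [← taylor_apply, taylor_coeff]
  exact h k hk

theorem squarefree_taylor {f : E[X]} (hf : Squarefree f) (x : E) : Squarefree (taylor x f) := by
  intro d hd
  have h := map_dvd (taylorEquiv x).symm hd
  rw [map_mul, ← coe_taylorEquiv] at h
  change _ ∣ (taylorEquiv x).symm (taylorEquiv x f) at h
  rw [AlgEquiv.symm_apply_apply] at h
  exact (MulEquiv.isUnit_map (taylorEquiv x).symm).1 (hf _ h)

variable [Fintype E]

/-- Modulo `X ^ q`, only the constant term of `f ^ q = f (X ^ q)` survives. -/
theorem X_pow_card_dvd (f : E[X]) :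
    (X : E[X]) ^ Fintype.card E ∣ f ^ Fintype.card E - C (f.coeff 0) := by
  obtain ⟨g, hg⟩ : (X : E[X]) ∣ f - C (f.coeff 0) := by
    rw [X_dvd_iff]; simp
  generalize f.coeff 0 = b at hg ⊢
  obtain rfl : f = X * g + C b := by rw [← hg]; ring
  refine ⟨expand E (Fintype.card E) g, ?_⟩
  rw [← FiniteField.expand_card, map_add, map_mul, expand_X, expand_C]
  ring

/-- Multiplying `r + s g`, `g = f ^ ((q - 1) / 2)`, by its conjugate and by `f` gives
`r ^ 2 f ≡ f(0) s ^ 2` modulo `X ^ q`, which is an equality for degree reasons. -/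
theorem eq_zero_of_X_pow_dvd (f : E[X]) (hq : Odd (Fintype.card E)) (hf : Squarefree f)
    (hd : 0 < f.natDegree) (h0 : f.coeff 0 ≠ 0) (c : ℕ)
    (hc : 2 * c + f.natDegree < Fintype.card E + 2) (r s : E[X])
    (hr : r.natDegree < c) (hs : s.natDegree < c)
    (h : (X : E[X]) ^ Fintype.card E ∣ r + s * f ^ ((Fintype.card E - 1) / 2)) :
    r = 0 ∧ s = 0 := by
  set q := Fintype.card E with hqdef
  have hq2 : (q - 1) / 2 * 2 + 1 = q := by obtain ⟨k, hk⟩ := hq; omega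
  have h1 : (X : E[X]) ^ q ∣ r ^ 2 * f - C (f.coeff 0) * s ^ 2 := by
    have e1 : r ^ 2 * f - C (f.coeff 0) * s ^ 2 =
        (r + s * f ^ ((q - 1) / 2)) * ((r - s * f ^ ((q - 1) / 2)) * f) +
          s ^ 2 * (f ^ q - C (f.coeff 0)) := by
      have : f ^ q = (f ^ ((q - 1) / 2)) ^ 2 * f := by
        rw [← pow_mul, ← pow_succ, hq2]
      rw [this]; ring
    rw [e1]
    exact dvd_add (h.mul_right _) ((X_pow_card_dvd f).mul_left _)
  have h2 : r ^ 2 * f - C (f.coeff 0) * s ^ 2 = 0 := by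
    refine eq_zero_of_dvd_of_natDegree_lt h1 ?_
    rw [natDegree_X_pow]
    refine lt_of_le_of_lt (natDegree_sub_le _ _) (max_lt ?_ ?_)
    · refine lt_of_le_of_lt (natDegree_mul_le_of_le natDegree_pow_le le_rfl) ?_
      omega
    · refine lt_of_le_of_lt (natDegree_C_mul_le _ _) (lt_of_le_of_lt natDegree_pow_le ?_)
      omega
  have h3 : r = 0 := eq_zero_of_sq_mul_eq f hf hd _ h0 r s (sub_eq_zero.1 h2)
  refine ⟨h3, ?_⟩
  subst h3
  simpa [h0] using h2

/-- Stepanov's auxiliary polynomial vanishes only if all its coefficients `r j`, `s j` do. -/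
theorem stepanov_coeffs_eq_zero (f : E[X]) (hq : Odd (Fintype.card E)) (hf : Squarefree f)
    (hd : 0 < f.natDegree) (h0 : f.coeff 0 ≠ 0) (c : ℕ)
    (hc : 2 * c + f.natDegree < Fintype.card E + 2) (J : ℕ) (r s : Fin J → E[X])
    (hr : ∀ j, (r j).natDegree < c) (hs : ∀ j, (s j).natDegree < c)
    (h : ∑ j, (r j + s j * f ^ ((Fintype.card E - 1) / 2)) * (X ^ Fintype.card E) ^ (j : ℕ) = 0) :
    r = 0 ∧ s = 0 := by
  induction J with
  | zero => exact ⟨Subsingleton.elim _ _, Subsingleton.elim _ _⟩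
  | succ J ih =>
    rw [Fin.sum_univ_succ] at h
    set q := Fintype.card E with hqdef
    have e : ∑ i : Fin J, (r i.succ + s i.succ * f ^ ((q - 1) / 2)) * (X ^ q) ^ (i.succ : ℕ) =
        X ^ q * ∑ i : Fin J, (r i.succ + s i.succ * f ^ ((q - 1) / 2)) * (X ^ q) ^ (i : ℕ) := by
      rw [Finset.mul_sum]
      refine Finset.sum_congr rfl fun i _ => ?_
      rw [Fin.val_succ, pow_succ]; ring
    rw [e] at h
    simp only [Fin.val_zero, pow_zero, mul_one] at h
    obtain ⟨hr0, hs0⟩ := eq_zero_of_X_pow_dvd f hq hf hd h0 c hc (r 0) (s 0) (hr 0) (hs 0)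
      ⟨_, eq_neg_of_add_eq_zero_left h |>.trans (mul_neg _ _).symm⟩
    rw [hr0, hs0, zero_mul, add_zero, zero_add] at h
    have h' := (mul_eq_zero.1 h).resolve_left (pow_ne_zero _ X_ne_zero)
    obtain ⟨h1, h2⟩ := ih (fun i => r i.succ) (fun i => s i.succ) (fun i => hr _) (fun i => hs _) h'
    constructor
    · funext i
      refine Fin.cases hr0 (fun i => congrFun h1 i) i
    · funext i
      refine Fin.cases hs0 (fun i => congrFun h2 i) i

theorem X_sub_C_pow_card (x : E) :
    (X - C x : E[X]) ^ Fintype.card E = X ^ Fintype.card E - C x := by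
  rw [← FiniteField.expand_card, map_sub, expand_X, expand_C]

/-- The auxiliary polynomial vanishes to order `M` at the points where `f ^ ((q - 1) / 2)` takes the
value `a`: modulo `(X - x) ^ M`, which divides `X ^ q - x`, the powers of `X ^ q` may be replaced by
constants, and then the linear equations `h` say that the first `M` Hasse derivatives vanish. -/
theorem stepanov_dvd (f : E[X]) (M J : ℕ) (hM : M ≤ Fintype.card E) (a x : E)
    (hx : (f ^ ((Fintype.card E - 1) / 2)).eval x = a)
    (r s : Fin J → E[X]) (D D' : ℕ → E[X] →ₗ[E] E[X])
    (hD : ∀ k < M, ∀ r, hasseDeriv k (f ^ M * r) = f ^ (M - k) * D k r)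
    (hD' : ∀ k < M, ∀ r, hasseDeriv k (f ^ (M + (Fintype.card E - 1) / 2) * r) =
      f ^ (M + (Fintype.card E - 1) / 2 - k) * D' k r)
    (h : ∀ k < M, ∑ j : Fin J, X ^ (j : ℕ) * (D k (r j) + C a * D' k (s j)) = 0) :
    (X - C x) ^ M ∣ f ^ M * ∑ j : Fin J, (r j + s j * f ^ ((Fintype.card E - 1) / 2)) *
      (X ^ Fintype.card E) ^ (j : ℕ) := by
  set q := Fintype.card E with hqdef
  set e := (q - 1) / 2
  -- With `X ^ q` replaced by its value `x`, the Hasse derivatives can be computed.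
  have h1 : (X - C x) ^ M ∣ f ^ M * ∑ j : Fin J, (r j + s j * f ^ e) * (C x) ^ (j : ℕ) := by
    apply X_sub_C_pow_dvd_of_hasseDeriv
    intro k hk
    have e1 : f ^ M * ∑ j : Fin J, (r j + s j * f ^ e) * (C x) ^ (j : ℕ) =
        ∑ j : Fin J, (x ^ (j : ℕ)) • (f ^ M * r j + f ^ (M + e) * s j) := by
      rw [Finset.mul_sum]
      refine Finset.sum_congr rfl fun j _ => ?_
      rw [smul_eq_C_mul, C_pow, pow_add]; ring
    rw [e1, map_sum, eval_finsetSum]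
    have e2 := congrArg (fun p => eval x (f ^ (M - k)) * eval x p) (h k hk)
    simp only [eval_zero, mul_zero, eval_finsetSum, Finset.mul_sum] at e2
    rw [← e2]
    refine Finset.sum_congr rfl fun j _ => ?_
    rw [map_smul, map_add, hD k hk, hD' k hk, show M + e - k = (M - k) + e by omega, pow_add]
    simp only [eval_smul, eval_add, eval_mul, hx, eval_pow, eval_X, eval_C, smul_eq_mul]
    ring
  have h2 : (X - C x) ^ M ∣ f ^ M * ∑ j : Fin J, (r j + s j * f ^ e) * (X ^ q) ^ (j : ℕ) -
      f ^ M * ∑ j : Fin J, (r j + s j * f ^ e) * (C x) ^ (j : ℕ) := by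
    rw [← mul_sub, ← Finset.sum_sub_distrib]
    refine Dvd.dvd.mul_left (Finset.dvd_sum fun j _ => ?_) _
    rw [← mul_sub]
    refine Dvd.dvd.mul_left ?_ _
    refine ((pow_dvd_pow _ hM).trans ?_).trans (sub_dvd_pow_sub_pow _ _ _)
    rw [hqdef, X_sub_C_pow_card]
  exact (dvd_iff_dvd_of_dvd_sub h2).2 h1

/-- The Stepanov bound for the number of points where the quadratic character takes a given
value, in terms of the free parameters. -/
theorem stepanov_card_le (f : E[X]) (hq : Odd (Fintype.card E)) (hf : Squarefree f)
    (hd : 0 < f.natDegree) (h0 : f.coeff 0 ≠ 0) (M c J : ℕ) (hc0 : 0 < c)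
    (hc : 2 * c + f.natDegree < Fintype.card E + 2) (hM : M ≤ Fintype.card E)
    (hcount : ∑ k ∈ Finset.range M, (k * f.natDegree + c + J) < 2 * J * c) (a : E) (Z : Finset E)
    (hZ : ∀ x ∈ Z, (f ^ ((Fintype.card E - 1) / 2)).eval x = a) :
    M * Z.card ≤ M * f.natDegree + (c + (Fintype.card E - 1) / 2 * f.natDegree) +
      Fintype.card E * (J - 1) := by
  classical
  set q := Fintype.card E with hqdef
  set e := (q - 1) / 2 with he
  set m := f.natDegree with hm
  have hDex : ∀ k, ∃ D : E[X] →ₗ[E] E[X], k < M →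
      (∀ r, hasseDeriv k (f ^ M * r) = f ^ (M - k) * D r) ∧
        ∀ r, (D r).natDegree ≤ k * m + r.natDegree := by
    intro k
    by_cases hk : k < M
    · obtain ⟨D, hD⟩ := exists_hasseDeriv_pow_mul f M k hk.le
      exact ⟨D, fun _ => hD⟩
    · exact ⟨0, fun h => absurd h hk⟩
  have hDex' : ∀ k, ∃ D : E[X] →ₗ[E] E[X], k < M →
      (∀ r, hasseDeriv k (f ^ (M + e) * r) = f ^ (M + e - k) * D r) ∧
        ∀ r, (D r).natDegree ≤ k * m + r.natDegree := by
    intro k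
    by_cases hk : k < M
    · obtain ⟨D, hD⟩ := exists_hasseDeriv_pow_mul f (M + e) k (by omega)
      exact ⟨D, fun _ => hD⟩
    · exact ⟨0, fun h => absurd h hk⟩
  choose D hD using hDex
  choose D' hD' using hDex'
  obtain ⟨r, s, hr, hs, hrs, hz⟩ := exists_stepanov_coeffs m M c J a D D'
    (fun k hk => (hD k hk).2) (fun k hk => (hD' k hk).2) hc0 hcount
  set R := f ^ M * ∑ j : Fin J, (r j + s j * f ^ e) * (X ^ q) ^ (j : ℕ) with hR
  have hR0 : R ≠ 0 := by
    refine mul_ne_zero (pow_ne_zero _ hf.ne_zero) fun h => hrs ?_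
    exact stepanov_coeffs_eq_zero f hq hf hd h0 c hc J r s hr hs h
  have hdvd : ∏ x ∈ Z, (X - C x) ^ M ∣ R := by
    refine Finset.prod_dvd_of_coprime ?_ fun x hx => ?_
    · intro x _ y _ hxy
      exact (pairwise_coprime_X_sub_C Function.injective_id hxy).pow
    · exact stepanov_dvd f M J hM a x (hZ x hx) r s D D' (fun k hk => (hD k hk).1)
        (fun k hk => (hD' k hk).1) hz
  have hdeg := natDegree_le_of_dvd hdvd hR0
  have hl : (∏ x ∈ Z, (X - C x) ^ M).natDegree = M * Z.card := by
    rw [natDegree_prod_of_monic _ _ fun x _ => (monic_X_sub_C x).pow M]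
    simp [mul_comm]
  rw [← hl]
  refine hdeg.trans ?_
  have hfp : ∀ n, (f ^ n).natDegree ≤ n * m := fun n => natDegree_pow_le
  rw [hR, add_assoc (M * m)]
  refine natDegree_mul_le_of_le (hfp M) (natDegree_sum_le_of_forall_le _ _ fun j _ => ?_)
  refine natDegree_mul_le_of_le ((natDegree_add_le _ _).trans (max_le ?_ ?_)) ?_
  · have := hr j; omega
  · exact natDegree_mul_le_of_le (hs j).le (hfp e)
  · rw [← pow_mul]
    refine (natDegree_X_pow_le _).trans ?_
    exact Nat.mul_le_mul_left _ (by omega)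

/-- The choice of parameters for which Stepanov's linear system has more unknowns than equations. -/
theorem sum_range_stepanov_lt (q m M c J : ℕ) (hm : 0 < m) (hM : 8 * m ≤ M) (hMq : M * M ≤ q)
    (hc : q ≤ 2 * c + m) (hJ1 : M + 4 * m ≤ 2 * J) (hJ2 : 2 * J ≤ M + 4 * m + 1) :
    ∑ k ∈ Finset.range M, (k * m + c + J) < 2 * J * c := by
  have h1 : 2 * ∑ k ∈ Finset.range M, (k * m + c + J) ≤ M * M * m + 2 * M * (c + J) := by
    have h2 : ∀ N, 2 * ∑ k ∈ Finset.range N, (k * m + c + J) ≤ N * N * m + 2 * N * (c + J) := by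
      intro N
      induction N with
      | zero => simp
      | succ N ih => rw [Finset.sum_range_succ]; nlinarith
    exact h2 M
  suffices h : M * M * m + 2 * M * (c + J) < 2 * (2 * J * c) by omega
  have h3 : (M + 4 * m) * c ≤ 2 * J * c := Nat.mul_le_mul_right _ hJ1
  have h4 : M * (2 * J) ≤ M * (M + 4 * m + 1) := Nat.mul_le_mul_left _ hJ2
  have h5 : 4 * m * q ≤ 4 * m * (2 * c + m) := Nat.mul_le_mul_left _ hc
  have h6 : m * (M * M) ≤ m * q := Nat.mul_le_mul_left _ hMq
  have h7 : 8 * m * M ≤ M * M := Nat.mul_le_mul_right _ hM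
  have h8 : m * (8 * m) ≤ m * M := Nat.mul_le_mul_left _ hM
  have h9 : M * M ≤ m * (M * M) := Nat.le_mul_of_pos_left _ hm
  have h10 : m * (8 * M) ≤ m * (M * M) :=
    Nat.mul_le_mul_left _ (Nat.mul_le_mul_right _ (by omega))
  have h11 : M ≤ m * M := Nat.le_mul_of_pos_left _ hm
  have h12 : 0 < m * M := Nat.mul_pos hm (by omega)
  nlinarith

/-- The Stepanov bound with `M = ⌊√q⌋`: essentially `#Z ≤ q / 2 + (5 / 2) √q deg f + deg f`. -/
theorem stepanov_card_le_sqrt (f : E[X]) (hq : Odd (Fintype.card E)) (hf : Squarefree f)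
    (hd : 0 < f.natDegree) (h0 : f.coeff 0 ≠ 0)
    (hM : 8 * f.natDegree ≤ Nat.sqrt (Fintype.card E)) (a : E) (Z : Finset E)
    (hZ : ∀ x ∈ Z, (f ^ ((Fintype.card E - 1) / 2)).eval x = a) :
    2 * (Nat.sqrt (Fintype.card E) * Z.card) ≤
      Fintype.card E * Nat.sqrt (Fintype.card E) + 5 * f.natDegree * Fintype.card E +
        2 * f.natDegree * Nat.sqrt (Fintype.card E) := by
  set q := Fintype.card E with hqdef
  set m := f.natDegree with hm
  set M := Nat.sqrt q with hMdef
  have hMq : M * M ≤ q := Nat.sqrt_le q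
  have hMq' : M ≤ q := Nat.sqrt_le_self q
  -- `c` is about the largest bound for which coefficients of degree `< c` are determined modulo
  -- `X ^ q`, and `J` exceeds `M / 2` just enough for the unknowns to outnumber the equations.
  obtain ⟨c, hc⟩ : ∃ c, c = (q - m + 1) / 2 := ⟨_, rfl⟩
  obtain ⟨J, hJ⟩ : ∃ J, J = (M + 4 * m + 1) / 2 := ⟨_, rfl⟩
  have h := stepanov_card_le f hq hf hd h0 M c J (by omega) (by omega) hMq'
    (sum_range_stepanov_lt q m M c J hd hM hMq (by omega) (by omega) (by omega)) a Z hZ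
  rw [← hm, ← hqdef] at h
  have h1 : 2 * ((q - 1) / 2 * m) ≤ q * m := by
    rw [← mul_assoc]; exact Nat.mul_le_mul_right _ (by omega)
  have h2 : q * (2 * (J - 1) + 1) ≤ q * (M + 4 * m) := Nat.mul_le_mul_left _ (by omega)
  have h3 : 2 * c ≤ q := by omega
  nlinarith

/-- Weil's bound when `√q ≥ 8 deg f` and `f(0) ≠ 0`. The Stepanov bounds for both values `1` and
`-1` are needed: each bounds a number of points from above, and hence the other one from below. -/
theorem abs_sum_quadraticChar_le_of_coeff_zero_ne [DecidableEq E] (f : E[X])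
    (hq : Odd (Fintype.card E)) (hf : Squarefree f) (hd : 0 < f.natDegree) (h0 : f.coeff 0 ≠ 0)
    (hM : 8 * f.natDegree ≤ Nat.sqrt (Fintype.card E)) :
    |((∑ x : E, quadraticChar E (f.eval x) : ℤ) : ℝ)| ≤
      8 * f.natDegree * Real.sqrt (Fintype.card E) := by
  set q := Fintype.card E with hqdef
  set m := f.natDegree with hm
  set M := Nat.sqrt q with hMdef
  have hchar : ringChar E ≠ 2 := by
    intro h
    have := FiniteField.even_card_of_char_two h
    obtain ⟨k, hk⟩ := hq
    omega
  set A := Finset.univ.filter fun x : E => quadraticChar E (f.eval x) = 1 with hA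
  set B := Finset.univ.filter fun x : E => quadraticChar E (f.eval x) = -1 with hB
  set N := Finset.univ.filter fun x : E => f.eval x = 0 with hN
  have hpow : ∀ x, (f ^ ((q - 1) / 2)).eval x = ((quadraticChar E (f.eval x) : ℤ) : E) := by
    intro x
    rw [quadraticChar_eq_pow_of_char_ne_two' hchar, eval_pow]
    congr 1
    obtain ⟨k, hk⟩ := hq
    omega
  have hAc := stepanov_card_le_sqrt f hq hf hd h0 hM 1 A (fun x hx => by
    rw [hpow, (Finset.mem_filter.1 hx).2]; simp)
  have hBc := stepanov_card_le_sqrt f hq hf hd h0 hM (-1) B (fun x hx => by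
    rw [hpow, (Finset.mem_filter.1 hx).2]; simp)
  have hNc : N.card ≤ m := by
    have : N ⊆ f.roots.toFinset := by
      intro x hx
      rw [Multiset.mem_toFinset, mem_roots hf.ne_zero]
      exact (Finset.mem_filter.1 hx).2
    exact (Finset.card_le_card this).trans ((Multiset.toFinset_card_le _).trans (card_roots' f))
  have htri : ∀ x : E, (1 : ℤ) = (if quadraticChar E (f.eval x) = 1 then 1 else 0) +
      (if quadraticChar E (f.eval x) = -1 then 1 else 0) + (if f.eval x = 0 then 1 else 0) := by
    intro x
    by_cases hx : f.eval x = 0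
    · simp [hx]
    · rcases quadraticChar_dichotomy hx with h | h <;> simp [h, hx]
  have hval : ∀ x : E, quadraticChar E (f.eval x) =
      (if quadraticChar E (f.eval x) = 1 then 1 else 0) -
      (if quadraticChar E (f.eval x) = -1 then 1 else 0) := by
    intro x
    by_cases hx : f.eval x = 0
    · simp [hx]
    · rcases quadraticChar_dichotomy hx with h | h <;> simp [h]
  have htot : (q : ℤ) = A.card + B.card + N.card := by
    have : ∑ x : E, (1 : ℤ) = q := by simp [hqdef]
    rw [← this, Finset.sum_congr rfl fun x _ => htri x, Finset.sum_add_distrib,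
      Finset.sum_add_distrib, Finset.sum_boole, Finset.sum_boole, Finset.sum_boole]
  have hS : ∑ x : E, quadraticChar E (f.eval x) = (A.card : ℤ) - B.card := by
    rw [Finset.sum_congr rfl fun x _ => hval x, Finset.sum_sub_distrib, Finset.sum_boole,
      Finset.sum_boole]
  set S := ∑ x : E, quadraticChar E (f.eval x) with hSdef
  clear_value S A B N
  have hAc' : 2 * ((M : ℤ) * A.card) ≤ q * M + 5 * m * q + 2 * m * M := by exact_mod_cast hAc
  have hBc' : 2 * ((M : ℤ) * B.card) ≤ q * M + 5 * m * q + 2 * m * M := by exact_mod_cast hBc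
  have hNc' : (N.card : ℤ) ≤ m := by exact_mod_cast hNc
  have hMN : (M : ℤ) * N.card ≤ M * m := mul_le_mul_of_nonneg_left hNc' (by positivity)
  have hS1 : (M : ℤ) * |S| ≤ 5 * m * q + 3 * m * M := by
    rw [← abs_of_nonneg (show (0 : ℤ) ≤ M by positivity), ← abs_mul,
      abs_of_nonneg (show (0 : ℤ) ≤ M by positivity), abs_le]
    constructor <;> nlinarith
  have hS2 : (M : ℝ) * |(S : ℝ)| ≤ 5 * m * q + 3 * m * M := by exact_mod_cast hS1
  have hs0 : 0 ≤ Real.sqrt q := Real.sqrt_nonneg _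
  have hs1 : Real.sqrt q * Real.sqrt q = q := Real.mul_self_sqrt (by positivity)
  have hs2 : Real.sqrt q ≤ M + 1 := Real.sqrt_le_iff.2 ⟨by positivity, by
    have h := (Nat.lt_succ_sqrt q).le
    rw [Nat.succ_eq_add_one] at h
    rw [pow_two]; exact_mod_cast h⟩
  have hs3 : (M : ℝ) ≤ Real.sqrt q := Real.le_sqrt_of_sq_le (by
    rw [pow_two]; exact_mod_cast Nat.sqrt_le q)
  have hM8 : (8 : ℝ) ≤ M := by
    have : 8 ≤ M := by omega
    exact_mod_cast this
  have hm0 : (0 : ℝ) ≤ m := by positivity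
  have hmain : (5 * m * q + 3 * m * M : ℝ) ≤ M * (8 * m * Real.sqrt q) := by
    have e1 : (5 * q + 3 * M : ℝ) ≤ M * (8 * Real.sqrt q) := by
      clear_value q M
      generalize Real.sqrt (q : ℝ) = s at hs0 hs1 hs2 hs3 ⊢
      rw [← hs1]
      nlinarith [mul_le_mul_of_nonneg_left hs2 hs0, mul_le_mul_of_nonneg_right hM8 hs0]
    nlinarith
  exact le_of_mul_le_mul_left (hS2.trans hmain) (by linarith)

theorem abs_sum_quadraticChar_le_card [DecidableEq E] (f : E[X]) :
    |((∑ x : E, quadraticChar E (f.eval x) : ℤ) : ℝ)| ≤ Fintype.card E := by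
  have : |∑ x : E, quadraticChar E (f.eval x)| ≤ (Fintype.card E : ℤ) := by
    refine (Finset.abs_sum_le_sum_abs _ _).trans ?_
    refine (Finset.sum_le_card_nsmul _ _ 1 fun x _ => ?_).trans (by simp)
    by_cases hx : f.eval x = 0
    · simp [hx]
    · rcases quadraticChar_dichotomy hx with h | h <;> simp [h]
  exact_mod_cast this

/-- Weil's bound for the quadratic character, with an absolute constant times the degree. For
`√q < 8 deg f` it is trivial; otherwise `f` has a nonzero value, moved to `0` by a translation. -/
theorem abs_sum_quadraticChar_le [DecidableEq E] (f : E[X]) (hq : Odd (Fintype.card E))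
    (hf : Squarefree f) (hd : 0 < f.natDegree) :
    |((∑ x : E, quadraticChar E (f.eval x) : ℤ) : ℝ)| ≤
      8 * f.natDegree * Real.sqrt (Fintype.card E) := by
  rcases Nat.lt_or_ge (Nat.sqrt (Fintype.card E)) (8 * f.natDegree) with hM | hM
  · refine (abs_sum_quadraticChar_le_card f).trans ?_
    have hs0 : 0 ≤ Real.sqrt (Fintype.card E) := Real.sqrt_nonneg _
    have hs1 : Real.sqrt (Fintype.card E) * Real.sqrt (Fintype.card E) = Fintype.card E :=
      Real.mul_self_sqrt (by positivity)
    have hs2 : Real.sqrt (Fintype.card E) ≤ 8 * f.natDegree := by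
      refine Real.sqrt_le_iff.2 ⟨by positivity, ?_⟩
      have h := (Nat.lt_succ_sqrt (Fintype.card E)).le.trans (Nat.mul_self_le_mul_self hM)
      rw [pow_two]; exact_mod_cast h
    nlinarith
  · obtain ⟨x₀, hx₀⟩ : ∃ x₀ : E, f.eval x₀ ≠ 0 := by
      by_contra! h
      have : Fintype.card E ≤ f.natDegree := by
        have : (Finset.univ : Finset E) ⊆ f.roots.toFinset := by
          intro x _
          rw [Multiset.mem_toFinset, mem_roots hf.ne_zero]
          exact h x
        exact (Finset.card_le_card this).trans
          ((Multiset.toFinset_card_le _).trans (card_roots' f))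
      have := Nat.sqrt_le_self (Fintype.card E)
      omega
    have hsum : ∑ x : E, quadraticChar E (f.eval x) =
        ∑ x : E, quadraticChar E ((taylor x₀ f).eval x) := by
      simp_rw [taylor_eval]
      exact (Equiv.sum_comp (Equiv.addRight x₀) fun x => quadraticChar E (f.eval x)).symm
    rw [hsum, ← natDegree_taylor f x₀]
    refine abs_sum_quadraticChar_le_of_coeff_zero_ne _ hq (squarefree_taylor hf x₀)
      (by rwa [natDegree_taylor])
      (by rwa [taylor_coeff_zero]) (by rwa [natDegree_taylor])

end Stepanov

/-! ### The recursion from the Euler product -/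

section Recursion

variable {F : Type u} [Field F]

theorem mem_hyperelliptic [Fintype F] {n : ℕ} {D : F[X]} :
    D ∈ hyperelliptic F n ↔ D.Monic ∧ Squarefree D ∧ D.natDegree = n := by
  simp [hyperelliptic]

open Classical in
theorem mem_primeDivisors {f P : F[X]} (hf : f ≠ 0) :
    P ∈ primeDivisors f ↔ P.Monic ∧ Irreducible P ∧ P ∣ f := by
  rw [primeDivisors, Multiset.mem_toFinset]
  constructor
  · intro h
    have hi := UniqueFactorizationMonoid.irreducible_of_normalized_factor P h
    exact ⟨(normalize_eq_self_iff_monic hi.ne_zero).1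
      (UniqueFactorizationMonoid.normalize_normalized_factor P h), hi,
      UniqueFactorizationMonoid.dvd_of_mem_normalizedFactors h⟩
  · rintro ⟨h1, h2, h3⟩
    exact (UniqueFactorizationMonoid.mem_normalizedFactors_iff' hf).2
      ⟨h2, h1.normalize_eq_self, h3⟩

theorem chi_one (f : F[X]) : chi 1 f = 1 := by
  simp [chi]

open Classical in
theorem chi_mul {P D : F[X]} (hP : P.Monic) (hi : Irreducible P) (hD : D ≠ 0) (f : F[X]) :
    chi (P * D) f = residueSymbol f P * chi D f := by
  unfold chi
  rw [UniqueFactorizationMonoid.normalizedFactors_mul hi.ne_zero hD,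
    UniqueFactorizationMonoid.normalizedFactors_irreducible hi, hP.normalize_eq_self]
  simp

theorem natDegree_eq_sum_primeDivisors {D : F[X]} (hm : D.Monic) (hs : Squarefree D) :
    D.natDegree = ∑ P ∈ primeDivisors D, P.natDegree := by
  classical
  have h : ∏ P ∈ primeDivisors D, P = D := by
    have h1 := UniqueFactorizationMonoid.prod_normalizedFactors_eq hm.ne_zero
    rw [hm.normalize_eq_self] at h1
    have h2 := (UniqueFactorizationMonoid.squarefree_iff_nodup_normalizedFactors hm.ne_zero).1 hs
    conv_rhs => rw [← h1]
    rw [primeDivisors, Finset.prod, Multiset.map_id']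
    congr 1
    convert h2.dedup
    simp [Multiset.toFinset]
  conv_lhs => rw [← h]
  exact natDegree_prod_of_monic _ _ fun P hP => ((mem_primeDivisors hm.ne_zero).1 hP).1

variable [Fintype F]

open Classical in
/-- The monic irreducible polynomials of degree `j`. -/
noncomputable def monicPrimes (F : Type u) [Field F] [Fintype F] (j : ℕ) : Finset F[X] :=
  (hyperelliptic F j).filter Irreducible

open Classical in
theorem mem_monicPrimes {j : ℕ} {P : F[X]} :
    P ∈ monicPrimes F j ↔ P.Monic ∧ Irreducible P ∧ P.natDegree = j := by
  rw [monicPrimes, Finset.mem_filter, mem_hyperelliptic]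
  constructor
  · rintro ⟨⟨h1, -, h2⟩, h3⟩; exact ⟨h1, h3, h2⟩
  · rintro ⟨h1, h2, h3⟩; exact ⟨⟨h1, h2.squarefree, h3⟩, h2⟩

theorem pairwiseDisjoint_monicPrimes (s : Set ℕ) : s.PairwiseDisjoint (monicPrimes F) := by
  intro i _ j _ hij
  rw [Function.onFun, Finset.disjoint_left]
  intro P hP hP'
  rw [mem_monicPrimes] at hP hP'
  exact hij (hP.2.2.symm.trans hP'.2.2)

/-- The sum of `χ_D(f)` over the monic squarefree `D` of degree `n`. -/
noncomputable def charSum (f : F[X]) (n : ℕ) : ℤ := ∑ D ∈ hyperelliptic F n, chi D f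

open Classical in
/-- The part of `charSum f n` with `D` not divisible by `P`. -/
noncomputable def coprimeCharSum (f P : F[X]) (n : ℕ) : ℤ :=
  ∑ D ∈ (hyperelliptic F n).filter fun D => ¬ P ∣ D, chi D f

open Classical in
theorem sum_dvd_of_lt {f P : F[X]} {n : ℕ} (hn : n < P.natDegree) :
    ∑ D ∈ (hyperelliptic F n).filter fun D => P ∣ D, chi D f = 0 := by
  rw [Finset.filter_false_of_mem, Finset.sum_empty]
  intro D hD h
  obtain ⟨h1, -, h3⟩ := mem_hyperelliptic.1 hD
  have := natDegree_le_of_dvd h h1.ne_zero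
  omega

open Classical in
theorem sum_dvd_of_le {f P : F[X]} (hP : P.Monic) (hi : Irreducible P) {n : ℕ}
    (hn : P.natDegree ≤ n) :
    ∑ D ∈ (hyperelliptic F n).filter fun D => P ∣ D, chi D f =
      residueSymbol f P * coprimeCharSum f P (n - P.natDegree) := by
  rw [coprimeCharSum, Finset.mul_sum]
  symm
  refine Finset.sum_nbij (fun D => P * D) ?_ ?_ ?_ ?_
  · intro D hD
    obtain ⟨hD, hPD⟩ := Finset.mem_filter.1 hD
    obtain ⟨h1, h2, h3⟩ := mem_hyperelliptic.1 hD
    refine Finset.mem_filter.2 ⟨mem_hyperelliptic.2 ⟨hP.mul h1, ?_, ?_⟩, dvd_mul_right _ _⟩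
    · rw [squarefree_mul_iff]
      exact ⟨(hi.isRelPrime_iff_not_dvd).2 hPD, hi.squarefree, h2⟩
    · rw [hP.natDegree_mul h1, h3]; omega
  · intro D _ D' _ h
    exact mul_left_cancel₀ hi.ne_zero h
  · intro D hD
    obtain ⟨hD, D', rfl⟩ := Finset.mem_filter.1 hD
    obtain ⟨h1, h2, h3⟩ := mem_hyperelliptic.1 hD
    have hm := hP.of_mul_monic_left h1
    rw [squarefree_mul_iff] at h2
    rw [hP.natDegree_mul hm] at h3
    refine ⟨D', Finset.mem_filter.2 ⟨mem_hyperelliptic.2 ⟨hm, h2.2.2, by omega⟩, ?_⟩, rfl⟩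
    exact (hi.isRelPrime_iff_not_dvd).1 h2.1
  · intro D hD
    obtain ⟨h1, h2, h3⟩ := mem_hyperelliptic.1 (Finset.mem_filter.1 hD).1
    exact (chi_mul hP hi h1.ne_zero f).symm

open Classical in
theorem charSum_eq_add (f P : F[X]) (n : ℕ) :
    charSum f n = (∑ D ∈ (hyperelliptic F n).filter fun D => P ∣ D, chi D f) +
      coprimeCharSum f P n :=
  (Finset.sum_filter_add_sum_filter_not _ _ _).symm

/-- Removing the Euler factor `1 + (f/P) u ^ deg P`, by expanding its inverse as a geometric
series. -/
theorem coprimeCharSum_eq_sum {f P : F[X]} (hP : P.Monic) (hi : Irreducible P) (n : ℕ) :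
    coprimeCharSum f P n = ∑ k ∈ Finset.range (n + 1),
      (if P.natDegree ∣ k then (-residueSymbol f P) ^ (k / P.natDegree) else 0) *
        charSum f (n - k) := by
  have hj : 0 < P.natDegree := hi.natDegree_pos
  have hfirst : ∀ N ≤ P.natDegree, ∀ b : ℕ → ℤ, 0 < N → ∑ k ∈ Finset.range N,
      (if P.natDegree ∣ k then (-residueSymbol f P) ^ (k / P.natDegree) else 0) * b k = b 0 := by
    intro N hN b hN0
    rw [Finset.sum_eq_single_of_mem 0 (Finset.mem_range.2 hN0)]
    · simp
    · intro k hk hk0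
      have := Finset.mem_range.1 hk
      rw [if_neg, zero_mul]
      exact Nat.not_dvd_of_pos_of_lt (by omega) (by omega)
  induction n using Nat.strong_induction_on with
  | _ n ih =>
  have h := charSum_eq_add f P n
  rcases Nat.lt_or_ge n P.natDegree with hn | hn
  · rw [sum_dvd_of_lt hn, zero_add] at h
    rw [← h, hfirst (n + 1) hn (fun k => charSum f (n - k)) (by omega), Nat.sub_zero]
  · rw [sum_dvd_of_le hP hi hn, ih _ (by omega)] at h
    rw [show n + 1 = P.natDegree + (n - P.natDegree + 1) by omega, Finset.sum_range_add,
      hfirst _ le_rfl (fun k => charSum f (n - k)) hj, Nat.sub_zero]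
    have h2 : coprimeCharSum f P n = charSum f n + -residueSymbol f P *
        ∑ k ∈ Finset.range (n - P.natDegree + 1),
          (if P.natDegree ∣ k then (-residueSymbol f P) ^ (k / P.natDegree) else 0) *
            charSum f (n - P.natDegree - k) := by rw [h]; ring
    rw [h2, Finset.mul_sum]
    congr 1
    refine Finset.sum_congr rfl fun k _ => ?_
    simp only [Nat.dvd_add_right (dvd_refl P.natDegree), Nat.add_div_left _ hj, Nat.sub_sub]
    split_ifs
    · rw [pow_succ]; ring
    · simp

/-- The coefficients of `u A'(u) / A(u)` for the Euler product
`A(u) = ∏ (1 + (f/P) u ^ deg P)` generating `charSum f`. -/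
noncomputable def primePowerSum (f : F[X]) (k : ℕ) : ℤ :=
  ∑ j ∈ k.divisors, ∑ P ∈ monicPrimes F j, -((j : ℤ) * (-residueSymbol f P) ^ (k / j))

/-- The coefficient form of `u A' = (u A' / A) A`, obtained by counting `deg D` as the sum of the
degrees of the primes dividing `D`. -/
theorem natCast_mul_charSum (f : F[X]) (n : ℕ) :
    (n : ℤ) * charSum f n =
      ∑ k ∈ Finset.range n, primePowerSum f (k + 1) * charSum f (n - (k + 1)) := by
  classical
  have h1 : (n : ℤ) * charSum f n = ∑ j ∈ Finset.Icc 1 n, ∑ P ∈ monicPrimes F j,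
      (j : ℤ) * ∑ D ∈ (hyperelliptic F n).filter fun D => P ∣ D, chi D f := by
    rw [charSum, Finset.mul_sum]
    have e1 : ∀ D ∈ hyperelliptic F n, (n : ℤ) * chi D f = ∑ j ∈ Finset.Icc 1 n,
        ∑ P ∈ monicPrimes F j, if P ∣ D then (j : ℤ) * chi D f else 0 := by
      intro D hD
      obtain ⟨h1, h2, h3⟩ := mem_hyperelliptic.1 hD
      have e2 : primeDivisors D = (Finset.Icc 1 n).biUnion fun j =>
          (monicPrimes F j).filter fun P => P ∣ D := by
        ext P
        rw [mem_primeDivisors h1.ne_zero]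
        simp only [Finset.mem_biUnion, Finset.mem_filter, mem_monicPrimes, Finset.mem_Icc]
        constructor
        · rintro ⟨a, b, c⟩
          exact ⟨P.natDegree, ⟨b.natDegree_pos, h3 ▸ natDegree_le_of_dvd c h1.ne_zero⟩,
            ⟨a, b, rfl⟩, c⟩
        · rintro ⟨j, -, ⟨a, b, -⟩, c⟩
          exact ⟨a, b, c⟩
      have e3 := natDegree_eq_sum_primeDivisors h1 h2
      rw [h3] at e3
      conv_lhs => rw [e3]
      rw [e2, Finset.sum_biUnion]
      · push_cast
        rw [Finset.sum_mul]
        refine Finset.sum_congr rfl fun j _ => ?_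
        rw [Finset.sum_mul, Finset.sum_filter]
        refine Finset.sum_congr rfl fun P hP => ?_
        rw [(mem_monicPrimes.1 hP).2.2]
      · exact (pairwiseDisjoint_monicPrimes _).mono fun _ => Finset.filter_subset _ _
    rw [Finset.sum_congr rfl e1, Finset.sum_comm]
    refine Finset.sum_congr rfl fun j _ => ?_
    rw [Finset.sum_comm]
    refine Finset.sum_congr rfl fun P _ => ?_
    rw [Finset.sum_filter, Finset.mul_sum]
    exact Finset.sum_congr rfl fun D _ => by split_ifs <;> simp
  have h2 : ∀ j, ∀ P ∈ monicPrimes F j,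
      (j : ℤ) * ∑ D ∈ (hyperelliptic F n).filter fun D => P ∣ D, chi D f =
      ∑ k ∈ Finset.range n, if j ∣ k + 1 then
        -((j : ℤ) * (-residueSymbol f P) ^ ((k + 1) / j)) * charSum f (n - (k + 1)) else 0 := by
    intro j P hP
    obtain ⟨hm, hi, rfl⟩ := mem_monicPrimes.1 hP
    have h := charSum_eq_add f P n
    rw [coprimeCharSum_eq_sum hm hi, Finset.sum_range_succ'] at h
    simp only [dvd_zero, if_true, Nat.zero_div, pow_zero, one_mul, Nat.sub_zero] at h
    have h' : (∑ D ∈ (hyperelliptic F n).filter fun D => P ∣ D, chi D f) =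
      - ∑ k ∈ Finset.range n, (if P.natDegree ∣ k + 1 then
        (-residueSymbol f P) ^ ((k + 1) / P.natDegree) else 0) * charSum f (n - (k + 1)) := by
      linarith
    rw [h', ← Finset.sum_neg_distrib, Finset.mul_sum]
    refine Finset.sum_congr rfl fun k _ => ?_
    split_ifs
    · ring
    · simp
  rw [h1, Finset.sum_congr rfl fun j _ => Finset.sum_congr rfl (h2 j)]
  have h3 : ∀ j, ∑ P ∈ monicPrimes F j, (∑ k ∈ Finset.range n, if j ∣ k + 1 then
        -((j : ℤ) * (-residueSymbol f P) ^ ((k + 1) / j)) * charSum f (n - (k + 1)) else 0) =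
      ∑ k ∈ Finset.range n, if j ∣ k + 1 then (∑ P ∈ monicPrimes F j,
        -((j : ℤ) * (-residueSymbol f P) ^ ((k + 1) / j))) * charSum f (n - (k + 1)) else 0 := by
    intro j
    rw [Finset.sum_comm]
    refine Finset.sum_congr rfl fun k _ => ?_
    split_ifs
    · rw [Finset.sum_mul]
    · simp
  rw [Finset.sum_congr rfl fun j _ => h3 j, Finset.sum_comm]
  refine Finset.sum_congr rfl fun k hk => ?_
  rw [← Finset.sum_filter, primePowerSum, Finset.sum_mul]
  refine Finset.sum_congr ?_ fun _ _ => rfl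
  ext j
  have := Finset.mem_range.1 hk
  simp only [Finset.mem_filter, Finset.mem_Icc, Nat.mem_divisors]
  constructor
  · rintro ⟨-, h⟩; exact ⟨h, by omega⟩
  · rintro ⟨h, -⟩
    exact ⟨⟨Nat.pos_of_dvd_of_pos h (by omega), (Nat.le_of_dvd (by omega) h).trans (by omega)⟩, h⟩

theorem charSum_zero (f : F[X]) : charSum f 0 = 1 := by
  have : hyperelliptic F 0 = {1} := by
    ext D
    rw [mem_hyperelliptic, Finset.mem_singleton]
    constructor
    · rintro ⟨h1, -, h3⟩
      exact h1.natDegree_eq_zero.1 h3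
    · rintro rfl
      exact ⟨monic_one, squarefree_one, natDegree_one⟩
  rw [charSum, this, Finset.sum_singleton, chi_one]

end Recursion

/-! ### Majorants for exponential recursions -/

section Majorant

/-- With `c n = |a n| r ^ n`, the truncated series `h(x) = ∑_{i ≤ n} c i x ^ i` satisfies the
differential inequality `h' ≤ G' h`, where `G(x) = ∑_{k ≤ n} t k r ^ k x ^ k / k`; hence
`h exp (-G)` decreases on `[0, 1]` and `h 1 ≤ exp (G 1)`. -/
theorem abs_mul_pow_le_exp_of_recursion (a T t : ℕ → ℝ) (r : ℝ) (hr : 0 ≤ r) (ha : a 0 = 1)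
    (hrec : ∀ n : ℕ, (n : ℝ) * a n = ∑ k ∈ Finset.range n, T (k + 1) * a (n - (k + 1)))
    (hT : ∀ k, |T (k + 1)| ≤ t (k + 1)) (n : ℕ) :
    |a n| * r ^ n ≤ Real.exp (∑ k ∈ Finset.range n, t (k + 1) * r ^ (k + 1) / (k + 1)) := by
  set c : ℕ → ℝ := fun i => |a i| * r ^ i with hc
  set s : ℕ → ℝ := fun k => t (k + 1) * r ^ (k + 1) with hs
  have hc0 : ∀ i, 0 ≤ c i := fun i => by positivity
  have hs0 : ∀ k, 0 ≤ s k := fun k =>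
    mul_nonneg ((abs_nonneg _).trans (hT k)) (pow_nonneg hr _)
  have hcrec : ∀ i : ℕ, (i : ℝ) * c i ≤ ∑ k ∈ Finset.range i, s k * c (i - (k + 1)) := by
    intro i
    have h1 : (i : ℝ) * c i = |∑ k ∈ Finset.range i, T (k + 1) * a (i - (k + 1))| * r ^ i := by
      rw [← hrec, abs_mul, Nat.abs_cast, hc, mul_assoc]
    rw [h1]
    refine (mul_le_mul_of_nonneg_right (Finset.abs_sum_le_sum_abs _ _)
      (pow_nonneg hr _)).trans ?_
    rw [Finset.sum_mul]
    refine Finset.sum_le_sum fun k hk => ?_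
    have hk' := Finset.mem_range.1 hk
    have e : r ^ i = r ^ (k + 1) * r ^ (i - (k + 1)) := by rw [← pow_add]; congr 1; omega
    rw [abs_mul, e, hs, hc]
    calc |T (k + 1)| * |a (i - (k + 1))| * (r ^ (k + 1) * r ^ (i - (k + 1)))
        ≤ t (k + 1) * |a (i - (k + 1))| * (r ^ (k + 1) * r ^ (i - (k + 1))) := by
          gcongr; exact hT k
      _ = _ := by ring
  set h : ℝ → ℝ := fun x => ∑ i ∈ Finset.range (n + 1), c i * x ^ i with hh
  set G : ℝ → ℝ := fun x => ∑ k ∈ Finset.range n, s k * x ^ (k + 1) / (k + 1) with hG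
  set g : ℝ → ℝ := fun x => ∑ k ∈ Finset.range n, s k * x ^ k with hg
  have hGd : ∀ x, HasDerivAt G (g x) x := by
    intro x
    refine HasDerivAt.fun_sum fun k _ => ?_
    have := ((hasDerivAt_pow (k + 1) x).const_mul (s k)).div_const ((k : ℝ) + 1)
    have hk : (k : ℝ) + 1 ≠ 0 := by positivity
    have e : s k * (((k + 1 : ℕ) : ℝ) * x ^ (k + 1 - 1)) / ((k : ℝ) + 1) = s k * x ^ k := by
      rw [Nat.add_sub_cancel]
      push_cast
      field_simp
    rwa [e] at this
  set h' : ℝ → ℝ := fun x => ∑ i ∈ Finset.range (n + 1), c i * ((i : ℝ) * x ^ (i - 1)) with hh'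
  have hhd : ∀ x, HasDerivAt h (h' x) x := by
    intro x
    exact HasDerivAt.fun_sum fun i _ => (hasDerivAt_pow i x).const_mul (c i)
  have hle : ∀ x, 0 ≤ x → h' x ≤ g x * h x := by
    intro x hx
    have e1 : h' x ≤ ∑ i ∈ Finset.range (n + 1), ∑ k ∈ Finset.range i,
        (s k * x ^ k) * (c (i - (k + 1)) * x ^ (i - (k + 1))) := by
      refine Finset.sum_le_sum fun i _ => ?_
      calc c i * ((i : ℝ) * x ^ (i - 1)) = (i : ℝ) * c i * x ^ (i - 1) := by ring
        _ ≤ (∑ k ∈ Finset.range i, s k * c (i - (k + 1))) * x ^ (i - 1) := by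
          gcongr; exact hcrec i
        _ = _ := by
          rw [Finset.sum_mul]
          refine Finset.sum_congr rfl fun k hk => ?_
          have hk' := Finset.mem_range.1 hk
          rw [show i - 1 = k + (i - (k + 1)) by omega, pow_add]
          ring
    refine e1.trans ?_
    rw [hg, hh, Finset.sum_mul_sum, ← Finset.sum_product', Finset.sum_sigma']
    rw [← Finset.sum_image (g := fun p : (_ : ℕ) × ℕ => (p.2, p.1 - (p.2 + 1)))
      (f := fun p : ℕ × ℕ => (s p.1 * x ^ p.1) * (c p.2 * x ^ p.2))]
    · refine Finset.sum_le_sum_of_subset_of_nonneg ?_ fun p _ _ => ?_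
      · intro p hp
        obtain ⟨⟨i, k⟩, hik, rfl⟩ := Finset.mem_image.1 hp
        simp only [Finset.mem_sigma, Finset.mem_range, Finset.mem_product] at hik ⊢
        omega
      · have := hs0 p.1
        have := hc0 p.2
        positivity
    · rintro ⟨i, k⟩ hp ⟨i', k'⟩ hp' h
      simp only [Finset.coe_sigma, Set.mem_sigma_iff, Finset.coe_range, Set.mem_Iio,
        Prod.mk.injEq] at hp hp' h
      obtain ⟨rfl, h⟩ := h
      obtain rfl : i = i' := by omega
      rfl
  have hanti : AntitoneOn (fun x => h x * Real.exp (-G x)) (Set.Icc 0 1) := by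
    refine antitoneOn_of_deriv_nonpos (convex_Icc 0 1) ?_ ?_ ?_
    · exact fun x _ => ((hhd x).mul ((hGd x).neg.exp)).continuousAt.continuousWithinAt
    · exact fun x _ => ((hhd x).mul ((hGd x).neg.exp)).differentiableAt.differentiableWithinAt
    · intro x hx
      rw [interior_Icc] at hx
      have := ((hhd x).fun_mul ((hGd x).fun_neg.exp)).deriv
      rw [this]
      have h2 := hle x hx.1.le
      have h3 := Real.exp_pos (-G x)
      nlinarith
  have hfin := hanti (Set.left_mem_Icc.2 zero_le_one) (Set.right_mem_Icc.2 zero_le_one) zero_le_one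
  have hG0 : G 0 = 0 := by simp [hG]
  have hh0 : h 0 = 1 := by
    rw [hh]
    simp only
    rw [Finset.sum_range_succ', Finset.sum_eq_zero]
    · simp [hc, ha]
    · intro i _; simp
  simp only [hG0, hh0, neg_zero, Real.exp_zero, mul_one] at hfin
  have hG1 : G 1 = ∑ k ∈ Finset.range n, t (k + 1) * r ^ (k + 1) / (k + 1) := by
    simp [hG, hs]
  have hh1 : c n ≤ h 1 := by
    rw [hh]
    simp only [one_pow, mul_one]
    exact Finset.single_le_sum (fun i _ => hc0 i) (Finset.mem_range.2 (Nat.lt_succ_self n))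
  rw [← hG1]
  have h4 : h 1 ≤ Real.exp (G 1) := by
    have h5 : h 1 = h 1 * Real.exp (-G 1) * Real.exp (G 1) := by
      rw [mul_assoc, ← Real.exp_add]; simp
    rw [h5]
    exact mul_le_of_le_one_left (Real.exp_pos _).le hfin
  exact hh1.trans h4

end Majorant

/-! ### Quadratic characters of extension fields -/

section PointCount

variable {F : Type u} [Field F]

theorem abs_residueSymbol_le (f P : F[X]) : |residueSymbol f P| ≤ 1 := by
  unfold residueSymbol
  split_ifs <;> simp

variable [Fintype F] {K : Type v} [Field K] [Fintype K] [Algebra F K]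

theorem splits_map_of_natDegree_dvd {P : F[X]} (hi : Irreducible P)
    (hd : P.natDegree ∣ Module.finrank F K) : (P.map (algebraMap F K)).Splits := by
  have h := (hi.natDegree_dvd_iff_dvd_X_pow_card_pow_sub_X).1 hd
  have hcard : Nat.card F ^ Module.finrank F K = Fintype.card K := by
    rw [Nat.card_eq_fintype_card, ← Module.card_eq_pow_finrank]
  rw [hcard] at h
  have h2 : P.map (algebraMap F K) ∣ X ^ Fintype.card K - X := by
    have := Polynomial.map_dvd (algebraMap F K) h
    simpa using this
  have h3 := splits_X_pow_nat_card_sub_X (K := K)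
  rw [Nat.card_eq_fintype_card] at h3
  exact Splits.of_dvd h3
    (FiniteField.X_pow_card_sub_X_ne_zero K Fintype.one_lt_card) h2

theorem card_filter_minpoly_eq [DecidableEq F[X]] {P : F[X]} (hm : P.Monic) (hi : Irreducible P)
    (hd : P.natDegree ∣ Module.finrank F K) :
    (Finset.univ.filter fun x : K => minpoly F x = P).card = P.natDegree := by
  classical
  rw [← card_rootSet_eq_natDegree (K := K) (PerfectField.separable_of_irreducible hi)
    (splits_map_of_natDegree_dvd hi hd), ← Set.toFinset_card]
  congr 1
  ext x
  rw [Finset.mem_filter, Set.mem_toFinset, mem_rootSet]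
  constructor
  · rintro ⟨-, rfl⟩
    exact ⟨hi.ne_zero, minpoly.aeval F x⟩
  · rintro ⟨-, h⟩
    exact ⟨Finset.mem_univ _, (minpoly.eq_of_irreducible_of_monic hi h hm).symm⟩

/-- Each monic irreducible polynomial of degree `j ∣ [K : F]` is the minimal polynomial of exactly
`j` elements of `K`. -/
theorem sum_minpoly (φ : F[X] → ℤ) :
    ∑ x : K, φ (minpoly F x) =
      ∑ j ∈ (Module.finrank F K).divisors, ∑ P ∈ monicPrimes F j, (j : ℤ) * φ P := by
  classical
  have hmaps : ∀ x ∈ (Finset.univ : Finset K), minpoly F x ∈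
      (Module.finrank F K).divisors.biUnion (monicPrimes F) := by
    intro x _
    have hx : IsIntegral F x := Algebra.IsIntegral.isIntegral x
    rw [Finset.mem_biUnion]
    refine ⟨(minpoly F x).natDegree, Nat.mem_divisors.2
      ⟨minpoly.degree_dvd hx, Module.finrank_pos.ne'⟩, ?_⟩
    exact mem_monicPrimes.2 ⟨minpoly.monic hx, minpoly.irreducible hx, rfl⟩
  rw [← Finset.sum_fiberwise_of_maps_to hmaps, Finset.sum_biUnion]
  · refine Finset.sum_congr rfl fun j hj => Finset.sum_congr rfl fun P hP => ?_
    obtain ⟨hm, hi, rfl⟩ := mem_monicPrimes.1 hP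
    rw [Finset.sum_congr rfl (g := fun _ => φ P) fun x hx => by rw [(Finset.mem_filter.1 hx).2],
      Finset.sum_const, card_filter_minpoly_eq hm hi (Nat.dvd_of_mem_divisors hj), nsmul_eq_mul]
  · exact pairwiseDisjoint_monicPrimes _

theorem ringChar_ne_two_of_odd_card (hq : Odd (Fintype.card F)) : ringChar F ≠ 2 := by
  intro h
  have := FiniteField.even_card_of_char_two h
  obtain ⟨k, hk⟩ := hq
  omega

/-- Euler's criterion in `F[X] / P`, `P = minpoly F x`, raised to the power
`(#K - 1) / (#(F[X] / P) - 1)`, which has the parity of `[K : F] / deg P`. -/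
theorem quadraticChar_aeval [DecidableEq K] (hq : Odd (Fintype.card F)) (f : F[X]) (x : K) :
    quadraticChar K (aeval x f) =
      residueSymbol f (minpoly F x) ^ (Module.finrank F K / (minpoly F x).natDegree) := by
  classical
  have hx : IsIntegral F x := Algebra.IsIntegral.isIntegral x
  set P := minpoly F x with hP
  have hi : Irreducible P := minpoly.irreducible hx
  have hd : P.natDegree ∣ Module.finrank F K := minpoly.degree_dvd hx
  have hKcard : Fintype.card K = Fintype.card F ^ Module.finrank F K := Module.card_eq_pow_finrank
  have hKodd : Odd (Fintype.card K) := by rw [hKcard]; exact hq.pow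
  have hKchar := ringChar_ne_two_of_odd_card hKodd
  have hpos : 0 < Module.finrank F K / P.natDegree :=
    Nat.div_pos (Nat.le_of_dvd Module.finrank_pos hd) hi.natDegree_pos
  have hdvd : P ∣ f ↔ aeval x f = 0 := minpoly.dvd_iff
  unfold residueSymbol
  by_cases h0 : P ∣ f
  · rw [if_pos h0, hdvd.1 h0, quadraticChar_zero, zero_pow hpos.ne']
  have hne : aeval x f ≠ 0 := fun h => h0 (hdvd.2 h)
  rw [if_neg h0]
  by_cases hsq : ∃ g : F[X], P ∣ f - g ^ 2
  · rw [if_pos hsq, one_pow]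
    obtain ⟨g, hg⟩ := hsq
    have h1 : aeval x f = aeval x g ^ 2 := by
      have := minpoly.dvd_iff.1 hg
      rw [map_sub, map_pow] at this
      exact sub_eq_zero.1 this
    rw [h1]
    exact quadraticChar_sq_one' fun h => hne (by rw [h1, h]; simp)
  rw [if_neg hsq]
  have : Fact (Irreducible P) := ⟨hi⟩
  let E := AdjoinRoot P
  have : Module.Finite F E := (AdjoinRoot.powerBasis hi.ne_zero).finite
  have : Finite E := Module.finite_of_finite F
  let : Fintype E := Fintype.ofFinite E
  have hEcard : Fintype.card E = Fintype.card F ^ P.natDegree := by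
    rw [Module.card_eq_pow_finrank (K := F) (V := E), (AdjoinRoot.powerBasis hi.ne_zero).finrank,
      AdjoinRoot.powerBasis_dim]
  have hEodd : Odd (Fintype.card E) := by rw [hEcard]; exact hq.pow
  have hEchar := ringChar_ne_two_of_odd_card hEodd
  let φ : E →ₐ[F] K := AdjoinRoot.liftAlgHom P (Algebra.ofId F K) x (minpoly.aeval F x)
  have hφ : φ (AdjoinRoot.mk P f) = aeval x f := by
    simp only [φ]
    rfl
  have hy0 : AdjoinRoot.mk P f ≠ 0 := fun h => h0 (AdjoinRoot.mk_eq_zero.1 h)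
  have hynsq : ¬ IsSquare (AdjoinRoot.mk P f) := by
    rintro ⟨z, hz⟩
    obtain ⟨g, rfl⟩ := AdjoinRoot.mk_surjective z
    refine hsq ⟨g, AdjoinRoot.mk_eq_mk.1 ?_⟩
    rw [hz, map_pow, pow_two]
  have hy : (AdjoinRoot.mk P f) ^ (Fintype.card E / 2) = -1 :=
    (FiniteField.pow_dichotomy hEchar hy0).resolve_left fun h =>
      hynsq ((FiniteField.isSquare_iff hEchar hy0).2 h)
  have hy' : (aeval x f) ^ (Fintype.card E / 2) = -1 := by
    rw [← hφ, ← map_pow, hy, map_neg, map_one]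
  obtain ⟨n, hn⟩ := hd
  have hndiv : Module.finrank F K / P.natDegree = n := by
    rw [hn, Nat.mul_div_cancel_left _ hi.natDegree_pos]
  rw [hndiv]
  -- `N` is the geometric sum `1 + Q + ⋯ + Q ^ (n - 1)`, a sum of `n` odd numbers.
  have hexp : ∃ N, Fintype.card K / 2 = Fintype.card E / 2 * N ∧ (Even N ↔ Even n) := by
    rw [hKcard, hn, pow_mul, ← hEcard]
    generalize Fintype.card E = Q at hEodd
    refine ⟨∑ i ∈ Finset.range n, Q ^ i, ?_, ?_⟩
    · obtain ⟨h, rfl⟩ := hEodd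
      have h2 : (∑ i ∈ Finset.range n, (2 * h + 1) ^ i) * (2 * h) + 1 = (2 * h + 1) ^ n := by
        have := geom_sum_mul_add (2 * h) n
        simpa using this
      rw [← h2, show (2 * h + 1) / 2 = h by omega]
      rw [show (∑ i ∈ Finset.range n, (2 * h + 1) ^ i) * (2 * h) + 1 =
        2 * (h * (∑ i ∈ Finset.range n, (2 * h + 1) ^ i)) + 1 by ring]
      omega
    · clear hn hndiv
      induction n with
      | zero => simp
      | succ n ih =>
        rw [Finset.sum_range_succ, Nat.even_add, ih, Nat.even_add_one]
        have : ¬ Even (Q ^ n) := Nat.not_even_iff_odd.2 hEodd.pow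
        tauto
  obtain ⟨N, hN, hpar⟩ := hexp
  have hc : ((quadraticChar K (aeval x f) : ℤ) : K) = (-1) ^ n := by
    rw [quadraticChar_eq_pow_of_char_ne_two' hKchar, hN, pow_mul, hy']
    rcases Nat.even_or_odd n with h | h
    · rw [h.neg_one_pow, (hpar.2 h).neg_one_pow]
    · have : Odd N := by
        rw [← Nat.not_even_iff_odd, hpar, Nat.not_even_iff_odd]; exact h
      rw [h.neg_one_pow, this.neg_one_pow]
  have h1 : (-1 : K) ≠ 1 := Ring.neg_one_ne_one_of_char_ne_two hKchar
  rcases Nat.even_or_odd n with h | h <;> rw [h.neg_one_pow] at hc ⊢ <;>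
    rcases quadraticChar_dichotomy hne with h' | h' <;> rw [h'] at hc ⊢ <;> simp at hc
  · exact absurd hc h1
  · exact absurd hc.symm h1

/-- If `[K : F] / deg x` is even, then `x` lies in the subfield of `K` over which `K` has degree
two. -/
theorem card_even_le :
    (Finset.univ.filter fun x : K => Even (Module.finrank F K / (minpoly F x).natDegree)).card ≤
      Fintype.card F ^ (Module.finrank F K / 2) := by
  classical
  by_cases hev : Even (Module.finrank F K)
  swap
  · rw [Finset.card_eq_zero.2]
    · exact Nat.zero_le _
    · rw [Finset.filter_eq_empty_iff]
      intro x _ h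
      refine hev ?_
      have hd := minpoly.degree_dvd (K := F) (L := K) (Algebra.IsIntegral.isIntegral x)
      rw [← Nat.div_mul_cancel hd]
      exact h.mul_right _
  set k := Module.finrank F K with hk
  have hkpos : 0 < k := Module.finrank_pos
  have hk2 : k / 2 ≠ 0 := by obtain ⟨m, hm⟩ := hev; omega
  have hne : (X ^ (Fintype.card F) ^ (k / 2) - X : K[X]) ≠ 0 :=
    FiniteField.X_pow_card_pow_sub_X_ne_zero K hk2 Fintype.one_lt_card
  have hsub : (Finset.univ.filter fun x : K => Even (k / (minpoly F x).natDegree)) ⊆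
      (X ^ (Fintype.card F) ^ (k / 2) - X : K[X]).roots.toFinset := by
    intro x hx
    rw [Finset.mem_filter] at hx
    have hint : IsIntegral F x := Algebra.IsIntegral.isIntegral x
    have hd : (minpoly F x).natDegree ∣ k / 2 := by
      obtain ⟨m, hm⟩ := hx.2
      have hd := minpoly.degree_dvd (K := F) (L := K) (Algebra.IsIntegral.isIntegral x)
      have h3 := Nat.div_mul_cancel hd
      rw [← hk, hm] at h3
      refine ⟨m, ?_⟩
      rw [← h3, ← two_mul, mul_assoc, Nat.mul_div_cancel_left _ two_pos, mul_comm]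
    have h := ((minpoly.irreducible hint).natDegree_dvd_iff_dvd_X_pow_card_pow_sub_X).1 hd
    rw [Nat.card_eq_fintype_card] at h
    have h2 := minpoly.dvd_iff.1 h
    rw [Multiset.mem_toFinset, mem_roots hne, IsRoot.def]
    simpa using h2
  refine (Finset.card_le_card hsub).trans ((Multiset.toFinset_card_le _).trans ?_)
  refine (card_roots' _).trans ?_
  rw [FiniteField.X_pow_card_pow_sub_X_natDegree_eq K hk2 Fintype.one_lt_card]

end PointCount

/-! ### Coefficients of the logarithmic derivative -/

section Bounds

variable {F : Type u} [Field F]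

theorem residueSymbol_of_dvd {f P : F[X]} (h : P ∣ f) : residueSymbol f P = 0 := by
  rw [residueSymbol, if_pos h]

open Classical in
theorem residueSymbol_mul_sq (f g : F[X]) {P : F[X]} (hi : Irreducible P) (h : ¬ P ∣ g) :
    residueSymbol (f * g ^ 2) P = residueSymbol f P := by
  have hg : ¬ P ∣ g ^ 2 := fun h' => h (hi.prime.dvd_of_dvd_pow h')
  have h1 : P ∣ f * g ^ 2 ↔ P ∣ f := hi.prime.dvd_mul.trans (or_iff_left hg)
  have h2 : (∃ s, P ∣ f * g ^ 2 - s ^ 2) ↔ ∃ s, P ∣ f - s ^ 2 := by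
    constructor
    · rintro ⟨s, hs⟩
      obtain ⟨a, b, hab⟩ : IsCoprime g P := (hi.coprime_iff_not_dvd.2 h).symm
      refine ⟨s * a, ?_⟩
      have e : f - (s * a) ^ 2 = P * (b * (1 + a * g) * f) + (f * g ^ 2 - s ^ 2) * a ^ 2 := by
        linear_combination (-(1 + a * g) * f) * hab
      rw [e]
      exact dvd_add (dvd_mul_right _ _) (hs.mul_right _)
    · rintro ⟨s, hs⟩
      refine ⟨s * g, ?_⟩
      rw [mul_pow, ← sub_mul]
      exact hs.mul_right _
  exact if_congr h1 rfl (if_congr h2 rfl rfl)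

open Classical in
theorem abs_chi_le (D f : F[X]) : |chi D f| ≤ 1 := by
  unfold chi
  induction UniqueFactorizationMonoid.normalizedFactors D using Multiset.induction_on with
  | empty => simp
  | cons P s ih =>
    rw [Multiset.map_cons, Multiset.prod_cons, abs_mul]
    exact mul_le_one₀ (abs_residueSymbol_le f P) (abs_nonneg _) ih

variable [Fintype F]

theorem card_hyperelliptic_le (n : ℕ) : (hyperelliptic F n).card ≤ Fintype.card F ^ n := by
  classical
  have : (hyperelliptic F n).card ≤ (Finset.univ : Finset (Fin n → F)).card := by
    refine Finset.card_le_card_of_injOn (fun D i => D.coeff i)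
      (fun _ _ => Finset.mem_coe.2 (Finset.mem_univ _)) ?_
    intro D hD D' hD' h
    obtain ⟨h1, -, h2⟩ := mem_hyperelliptic.1 (Finset.mem_coe.1 hD)
    obtain ⟨h1', -, h2'⟩ := mem_hyperelliptic.1 (Finset.mem_coe.1 hD')
    ext i
    rcases lt_trichotomy i n with hi | rfl | hi
    · exact congrFun h ⟨i, hi⟩
    · rw [← h2, h1.coeff_natDegree, h2, ← h2', h1'.coeff_natDegree]
    · rw [coeff_eq_zero_of_natDegree_lt (h2 ▸ hi), coeff_eq_zero_of_natDegree_lt (h2' ▸ hi)]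
  simpa using this

theorem abs_charSum_le (f : F[X]) (n : ℕ) : |charSum f n| ≤ (Fintype.card F : ℤ) ^ n := by
  refine (Finset.abs_sum_le_sum_abs _ _).trans
    ((Finset.sum_le_card_nsmul _ _ 1 fun D _ => abs_chi_le D f).trans ?_)
  rw [nsmul_eq_mul, mul_one]
  exact_mod_cast card_hyperelliptic_le n

theorem exists_extension (F : Type u) [Field F] [Fintype F] (k : ℕ) (hk : k ≠ 0) :
    ∃ (K : Type) (_ : Field K) (_ : Fintype K) (_ : Algebra F K), Module.finrank F K = k := by
  obtain ⟨p, hp⟩ := CharP.exists F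
  have : Fact p.Prime := ⟨CharP.char_is_prime F p⟩
  have : NeZero k := ⟨hk⟩
  exact ⟨FiniteField.Extension F p k, inferInstance, Fintype.ofFinite _, inferInstance,
    FiniteField.finrank_extension F p k⟩

theorem card_monicPrimes_le (k : ℕ) (hk : k ≠ 0) :
    (monicPrimes F k).card ≤ Fintype.card F ^ k := by
  obtain ⟨K, _, _, _, hK⟩ := exists_extension F k hk
  have h := sum_minpoly (F := F) (K := K) fun _ => 1
  rw [hK] at h
  have hKc : Fintype.card K = Fintype.card F ^ k := by
    rw [Module.card_eq_pow_finrank (K := F) (V := K), hK]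
  have h1 : ((monicPrimes F k).card : ℤ) ≤ Fintype.card K := by
    have e : ∑ _x : K, (1 : ℤ) = Fintype.card K := by simp
    rw [← e, h]
    have h2 : ∑ P ∈ monicPrimes F k, (k : ℤ) * 1 ≤
        ∑ j ∈ k.divisors, ∑ P ∈ monicPrimes F j, (j : ℤ) * 1 :=
      Finset.single_le_sum (f := fun j => ∑ P ∈ monicPrimes F j, (j : ℤ) * 1)
        (fun j _ => Finset.sum_nonneg fun P _ => by positivity)
        (Nat.mem_divisors_self k hk)
    refine le_trans ?_ h2
    rw [Finset.sum_const, nsmul_eq_mul, mul_one]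
    have : (1 : ℤ) ≤ k := by exact_mod_cast Nat.one_le_iff_ne_zero.2 hk
    nlinarith
  rw [hKc] at h1
  exact_mod_cast h1

/-- The two sums agree term by term except at the `x` whose minimal polynomial divides `g` (an error
of at most `1`) and at those with `[K : F] / deg x` even, where the signs differ. -/
theorem abs_primePowerSum_sub_le {K : Type} [Field K] [Fintype K] [DecidableEq K] [Algebra F K]
    (hq : Odd (Fintype.card F)) (f g : F[X]) (hg : g ≠ 0) :
    |primePowerSum (f * g ^ 2) (Module.finrank F K) - ∑ x : K, quadraticChar K (aeval x f)| ≤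
      (∑ P ∈ primeDivisors g, if P.natDegree ∣ Module.finrank F K then (P.natDegree : ℤ) else 0) +
        2 * (Fintype.card F : ℤ) ^ (Module.finrank F K / 2) := by
  classical
  set k := Module.finrank F K with hk
  have hkpos : 0 < k := Module.finrank_pos
  have h1 : primePowerSum (f * g ^ 2) k = ∑ x : K,
      -(-residueSymbol (f * g ^ 2) (minpoly F x)) ^ (k / (minpoly F x).natDegree) := by
    rw [sum_minpoly fun P => -(-residueSymbol (f * g ^ 2) P) ^ (k / P.natDegree), primePowerSum]
    refine Finset.sum_congr rfl fun j _ => Finset.sum_congr rfl fun P hP => ?_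
    rw [(mem_monicPrimes.1 hP).2.2]
    ring
  have h2 : ∀ x : K, |-(-residueSymbol (f * g ^ 2) (minpoly F x)) ^ (k / (minpoly F x).natDegree) -
      quadraticChar K (aeval x f)| ≤ (if minpoly F x ∣ g then 1 else 0) +
        2 * (if Even (k / (minpoly F x).natDegree) then 1 else 0) := by
    intro x
    have hx : IsIntegral F x := Algebra.IsIntegral.isIntegral x
    rw [quadraticChar_aeval hq, ← hk]
    have hpos : k / (minpoly F x).natDegree ≠ 0 :=
      (Nat.div_pos (Nat.le_of_dvd hkpos (minpoly.degree_dvd hx)) (minpoly.natDegree_pos hx)).ne'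
    have hs := abs_residueSymbol_le f (minpoly F x)
    have hsp := pow_le_one₀ (n := k / (minpoly F x).natDegree) (abs_nonneg _) hs
    rw [← abs_pow] at hsp
    by_cases hd : minpoly F x ∣ g
    · rw [residueSymbol_of_dvd ((hd.trans (dvd_pow_self g two_ne_zero)).mul_left f), neg_zero,
        zero_pow hpos, if_pos hd, neg_zero, zero_sub, abs_neg]
      split_ifs <;> linarith
    · rw [residueSymbol_mul_sq f g (minpoly.irreducible hx) hd, if_neg hd]
      rcases Nat.even_or_odd (k / (minpoly F x).natDegree) with h | h
      · rw [if_pos h, h.neg_pow]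
        rw [abs_le] at hsp ⊢
        constructor <;> linarith
      · rw [h.neg_pow]
        simp only [neg_neg, sub_self, abs_zero, zero_add]
        split_ifs <;> simp
  rw [h1, ← Finset.sum_sub_distrib]
  refine (Finset.abs_sum_le_sum_abs _ _).trans ((Finset.sum_le_sum fun x _ => h2 x).trans ?_)
  rw [Finset.sum_add_distrib, ← Finset.mul_sum]
  refine add_le_add (le_of_eq ?_) (mul_le_mul_of_nonneg_left ?_ zero_le_two)
  · rw [sum_minpoly fun P => if P ∣ g then 1 else 0, ← Finset.sum_filter, ← hk]
    have e : (primeDivisors g).filter (fun P => P.natDegree ∣ k) = k.divisors.biUnion fun j =>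
        (monicPrimes F j).filter fun P => P ∣ g := by
      ext P
      rw [Finset.mem_filter, mem_primeDivisors hg]
      simp only [Finset.mem_biUnion, Finset.mem_filter, mem_monicPrimes, Nat.mem_divisors]
      constructor
      · rintro ⟨⟨a, b, c⟩, d⟩
        exact ⟨P.natDegree, ⟨d, hkpos.ne'⟩, ⟨a, b, rfl⟩, c⟩
      · rintro ⟨j, ⟨d, -⟩, ⟨a, b, rfl⟩, c⟩
        exact ⟨⟨a, b, c⟩, d⟩
    rw [e, Finset.sum_biUnion]
    · refine Finset.sum_congr rfl fun j _ => ?_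
      rw [Finset.sum_filter]
      refine Finset.sum_congr rfl fun P hP => ?_
      rw [(mem_monicPrimes.1 hP).2.2]
      split_ifs <;> simp
    · exact (pairwiseDisjoint_monicPrimes _).mono fun _ => Finset.filter_subset _ _
  · rw [Finset.sum_boole]
    exact_mod_cast card_even_le (F := F) (K := K)

theorem abs_primePowerSum_le (hq : Odd (Fintype.card F)) (f g : F[X]) (hf : Squarefree f)
    (hd : 0 < f.natDegree) (hg : g ≠ 0) (k : ℕ) (hk : k ≠ 0) :
    |(primePowerSum (f * g ^ 2) k : ℝ)| ≤
      min (8 * f.natDegree * Real.sqrt ((Fintype.card F : ℝ) ^ k)) ((Fintype.card F : ℝ) ^ k) +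
      (∑ P ∈ primeDivisors g, if P.natDegree ∣ k then (P.natDegree : ℝ) else 0) +
        2 * Real.sqrt ((Fintype.card F : ℝ) ^ k) := by
  classical
  obtain ⟨K, _, _, _, hK⟩ := exists_extension F k hk
  have hKc : Fintype.card K = Fintype.card F ^ k := by
    rw [Module.card_eq_pow_finrank (K := F) (V := K), hK]
  have h := abs_primePowerSum_sub_le (K := K) hq f g hg
  rw [hK] at h
  set S : ℤ := ∑ x : K, quadraticChar K (aeval x f) with hS
  have hS' : S = ∑ x : K, quadraticChar K ((f.map (algebraMap F K)).eval x) := by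
    simp only [hS, eval_map_algebraMap]
  have hsf : Squarefree (f.map (algebraMap F K)) :=
    ((PerfectField.separable_iff_squarefree.2 hf).map (f := algebraMap F K)).squarefree
  have hS1 : |(S : ℝ)| ≤ 8 * f.natDegree * Real.sqrt ((Fintype.card F : ℝ) ^ k) := by
    have := abs_sum_quadraticChar_le (f.map (algebraMap F K)) (by rw [hKc]; exact hq.pow) hsf
      (by rwa [natDegree_map])
    rw [natDegree_map, hKc] at this
    rw [hS']
    exact_mod_cast this
  have hS2 : |(S : ℝ)| ≤ (Fintype.card F : ℝ) ^ k := by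
    have := abs_sum_quadraticChar_le_card (f.map (algebraMap F K))
    rw [hKc] at this
    rw [hS']
    exact_mod_cast this
  have h' : |(primePowerSum (f * g ^ 2) k : ℝ) - S| ≤
      (∑ P ∈ primeDivisors g, if P.natDegree ∣ k then (P.natDegree : ℝ) else 0) +
        2 * (Fintype.card F : ℝ) ^ (k / 2) := by exact_mod_cast h
  have hsq : (Fintype.card F : ℝ) ^ (k / 2) ≤ Real.sqrt ((Fintype.card F : ℝ) ^ k) := by
    refine Real.le_sqrt_of_sq_le ?_
    rw [← pow_mul]
    refine pow_le_pow_right₀ ?_ (by omega)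
    exact_mod_cast Fintype.card_pos
  have h3 := le_min hS1 hS2
  have h4 := abs_sub_abs_le_abs_sub (primePowerSum (f * g ^ 2) k : ℝ) S
  linarith

end Bounds

/-! ### Summing over prime powers -/

section Analysis

/-- The minimum of two numbers is at most any weighted geometric mean. -/
theorem min_le_rpow_mul_rpow {x y θ : ℝ} (hx : 0 < x) (hy : 0 < y) (h0 : 0 ≤ θ) (h1 : θ ≤ 1) :
    min x y ≤ x ^ θ * y ^ (1 - θ) := by
  have hm : 0 < min x y := lt_min hx hy
  calc min x y = min x y ^ θ * min x y ^ (1 - θ) := by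
        rw [← Real.rpow_add hm]; simp
    _ ≤ _ := mul_le_mul (Real.rpow_le_rpow hm.le (min_le_left _ _) h0)
        (Real.rpow_le_rpow hm.le (min_le_right _ _) (by linarith))
        (Real.rpow_nonneg hm.le _) (Real.rpow_nonneg hx.le _)

theorem sum_range_pow_le {ρ : ℝ} (h0 : 0 ≤ ρ) (h1 : ρ < 1) (n : ℕ) :
    ∑ k ∈ Finset.range n, ρ ^ k ≤ (1 - ρ)⁻¹ :=
  sum_le_hasSum _ (fun _ _ => pow_nonneg h0 _) (hasSum_geometric_of_lt_one h0 h1)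

theorem sum_pow_succ_div_le {ρ : ℝ} (h0 : 0 ≤ ρ) (h1 : ρ < 1) (n : ℕ) :
    ∑ k ∈ Finset.range n, ρ ^ (k + 1) / ((k : ℝ) + 1) ≤ (1 - ρ)⁻¹ := by
  refine (Finset.sum_le_sum (g := fun k => ρ ^ k) fun k _ => ?_).trans
    (sum_range_pow_le h0 h1 n)
  refine (div_le_self (by positivity) (by linarith [(Nat.cast_nonneg k : (0 : ℝ) ≤ k)])).trans ?_
  exact pow_le_pow_of_le_one h0 h1.le (Nat.le_succ k)

/-- The terms with `k + 1 = j m` form a partial sum of the series of `-log (1 - y)` at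
`y = r ^ j`. -/
theorem sum_dvd_pow_div_le {r : ℝ} (h0 : 0 ≤ r) (h1 : r < 1) {j : ℕ} (hj : 0 < j) (n : ℕ) :
    ∑ k ∈ Finset.range n, (if j ∣ k + 1 then (j : ℝ) else 0) * r ^ (k + 1) / ((k : ℝ) + 1) ≤
      -Real.log (1 - r ^ j) := by
  have hy1 : r ^ j < 1 := pow_lt_one₀ h0 h1 hj.ne'
  have hy0 : 0 ≤ r ^ j := pow_nonneg h0 _
  have hs := Real.hasSum_pow_div_log_of_abs_lt_one (x := r ^ j) (by rwa [abs_of_nonneg hy0])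
  have e : ∑ k ∈ Finset.range n, (if j ∣ k + 1 then (j : ℝ) else 0) * r ^ (k + 1) / ((k : ℝ) + 1) =
      ∑ m ∈ ((Finset.range n).filter fun k => j ∣ k + 1).image (fun k => (k + 1) / j - 1),
        (r ^ j) ^ (m + 1) / ((m : ℝ) + 1) := by
    rw [Finset.sum_image, Finset.sum_filter]
    · refine Finset.sum_congr rfl fun k _ => ?_
      split_ifs with h
      · obtain ⟨m, hm⟩ := h
        have hm0 : 0 < m := Nat.pos_of_ne_zero (by rintro rfl; omega)
        rw [hm, Nat.mul_div_cancel_left _ hj, Nat.sub_add_cancel hm0, ← pow_mul]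
        have h1 : (k : ℝ) + 1 = j * m := by exact_mod_cast hm
        have h2 : ((m - 1 : ℕ) : ℝ) + 1 = m := by exact_mod_cast Nat.sub_add_cancel hm0
        rw [h1, h2]
        have : (j : ℝ) ≠ 0 := by positivity
        rw [mul_div_mul_left _ _ this]
      · simp
    · intro k hk k' hk' h
      obtain ⟨m, hm⟩ := (Finset.mem_filter.1 (Finset.mem_coe.1 hk)).2
      obtain ⟨m', hm'⟩ := (Finset.mem_filter.1 (Finset.mem_coe.1 hk')).2
      have hm0 : 0 < m := Nat.pos_of_ne_zero (by rintro rfl; omega)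
      have hm0' : 0 < m' := Nat.pos_of_ne_zero (by rintro rfl; omega)
      simp only at h
      rw [hm, hm', Nat.mul_div_cancel_left _ hj, Nat.mul_div_cancel_left _ hj] at h
      obtain rfl : m = m' := by omega
      omega
  rw [e]
  exact sum_le_hasSum _ (fun m _ => by positivity) hs

theorem neg_log_one_sub_le {y : ℝ} (h0 : 0 ≤ y) (h1 : y ^ 2 ≤ 1 / 2) :
    -Real.log (1 - y) ≤ Real.log (1 + y) + 2 * y ^ 2 := by
  have hy : y < 1 := by nlinarith
  have h := Real.one_sub_inv_le_log_of_pos (show 0 < 1 - y ^ 2 by nlinarith)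
  rw [show 1 - y ^ 2 = (1 - y) * (1 + y) by ring,
    Real.log_mul (by linarith) (by linarith)] at h
  have h2 : ((1 - y) * (1 + y))⁻¹ ≤ 1 + 2 * y ^ 2 := by
    rw [inv_le_comm₀ (by nlinarith) (by positivity), inv_le_iff_one_le_mul₀ (by positivity)]
    nlinarith [sq_nonneg y]
  linarith

theorem exists_const_mul_rpow_le (c ε : ℝ) (hc : 1 ≤ c) (hε : 0 < ε) (hε1 : ε < 1 / 2) :
    ∃ B : ℝ, ∀ d : ℝ, 1 ≤ d → c * d ^ (1 - 3 * ε / 2) ≤ d ^ (1 - ε) + B := by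
  refine ⟨c * c ^ (2 / ε), fun d hd => ?_⟩
  have hd0 : 0 < d := by linarith
  have hc0 : 0 < c := by linarith
  rcases le_total c (d ^ (ε / 2)) with h | h
  · have : c * d ^ (1 - 3 * ε / 2) ≤ d ^ (ε / 2) * d ^ (1 - 3 * ε / 2) := by gcongr
    rw [← Real.rpow_add hd0] at this
    rw [show ε / 2 + (1 - 3 * ε / 2) = 1 - ε by ring] at this
    have : 0 ≤ c * c ^ (2 / ε) := by positivity
    linarith
  · have h2 : d ≤ c ^ (2 / ε) := by
      have := Real.rpow_le_rpow (by positivity) h (show 0 ≤ 2 / ε by positivity)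
      rwa [← Real.rpow_mul hd0.le, show ε / 2 * (2 / ε) = 1 by field_simp, Real.rpow_one] at this
    have h3 : d ^ (1 - 3 * ε / 2) ≤ d := by
      conv_rhs => rw [← Real.rpow_one d]
      exact Real.rpow_le_rpow_of_exponent_le hd (by linarith)
    have h4 : 0 ≤ d ^ (1 - ε) := by positivity
    nlinarith

variable {F : Type u} [Field F] [Fintype F]

theorem three_le_card (hq : Odd (Fintype.card F)) : 3 ≤ Fintype.card F := by
  have := Fintype.one_lt_card (α := F)
  obtain ⟨k, hk⟩ := hq
  omega

/-- A bound uniform in `g`, since there are at most `q ^ j` monic irreducible polynomials of degree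
`j`. -/
theorem sum_primeDivisors_le {ρ r : ℝ} (hρ0 : 0 ≤ ρ) (hρ1 : ρ < 1)
    (h : Fintype.card F * r ^ 2 ≤ ρ) {g : F[X]} (hg : g ≠ 0) :
    ∑ P ∈ primeDivisors g, (r ^ P.natDegree) ^ 2 ≤ (1 - ρ)⁻¹ := by
  classical
  have hsub : primeDivisors g ⊆ (Finset.Icc 1 g.natDegree).biUnion (monicPrimes F) := by
    intro P hP
    obtain ⟨h1, h2, h3⟩ := (mem_primeDivisors hg).1 hP
    rw [Finset.mem_biUnion]
    exact ⟨P.natDegree, Finset.mem_Icc.2 ⟨h2.natDegree_pos, natDegree_le_of_dvd h3 hg⟩,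
      mem_monicPrimes.2 ⟨h1, h2, rfl⟩⟩
  calc ∑ P ∈ primeDivisors g, (r ^ P.natDegree) ^ 2
      ≤ ∑ P ∈ (Finset.Icc 1 g.natDegree).biUnion (monicPrimes F), (r ^ P.natDegree) ^ 2 :=
        Finset.sum_le_sum_of_subset_of_nonneg hsub fun _ _ _ => by positivity
    _ ≤ ∑ j ∈ Finset.Icc 1 g.natDegree, ∑ P ∈ monicPrimes F j, (r ^ P.natDegree) ^ 2 :=
        (Finset.sum_biUnion (pairwiseDisjoint_monicPrimes _)).le
    _ ≤ ∑ j ∈ Finset.Icc 1 g.natDegree, ρ ^ j := by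
        refine Finset.sum_le_sum fun j hj => ?_
        have hj0 : j ≠ 0 := by have := (Finset.mem_Icc.1 hj).1; omega
        rw [Finset.sum_congr rfl (g := fun _ => (r ^ j) ^ 2) fun P hP => by
          rw [(mem_monicPrimes.1 hP).2.2], Finset.sum_const, nsmul_eq_mul]
        calc ((monicPrimes F j).card : ℝ) * (r ^ j) ^ 2
            ≤ (Fintype.card F : ℝ) ^ j * (r ^ j) ^ 2 := by
              gcongr; exact_mod_cast card_monicPrimes_le j hj0
          _ = (Fintype.card F * r ^ 2) ^ j := by ring
          _ ≤ ρ ^ j := by gcongr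
    _ ≤ ∑ j ∈ Finset.range (g.natDegree + 1), ρ ^ j := by
        refine Finset.sum_le_sum_of_subset_of_nonneg ?_ fun _ _ _ => by positivity
        intro j hj
        have := (Finset.mem_Icc.1 hj).2
        exact Finset.mem_range.2 (by omega)
    _ ≤ (1 - ρ)⁻¹ := sum_range_pow_le hρ0 hρ1 _

/-- The bound for the character sum in terms of `d = deg f`: the exponent `1 - 3ε/2` is the
interpolation parameter between Weil's bound and the trivial one, and any value strictly between
`1 - 2ε` and `1 - ε` would do. -/
theorem abs_charSum_mul_pow_le (ε : ℝ) (hε : 0 < ε) (hε1 : ε < 1 / 2) (hq : Odd (Fintype.card F))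
    (f g : F[X]) (hf : Squarefree f) (hd : 0 < f.natDegree) (hg : g ≠ 0) (n : ℕ) (r ρ : ℝ)
    (hr : r = (Fintype.card F : ℝ) ^ (-(1 / 2 : ℝ) - ε)) (hρ : ρ = (3 : ℝ) ^ (-(ε / 4))) :
    |(charSum (f * g ^ 2) n : ℝ)| * r ^ n ≤
      Real.exp (8 * (1 - ρ)⁻¹ * (f.natDegree : ℝ) ^ (1 - 3 * ε / 2) + 4 * (1 - ρ)⁻¹) *
        ∏ P ∈ primeDivisors g, (1 + r ^ P.natDegree) := by
  set q : ℝ := (Fintype.card F : ℝ) with hqdef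
  set d : ℝ := (f.natDegree : ℝ) with hddef
  have hq3 : 3 ≤ q := by rw [hqdef]; exact_mod_cast three_le_card hq
  have hq0 : 0 < q := by linarith
  have hd1 : 1 ≤ d := by rw [hddef]; exact_mod_cast hd
  have hr0 : 0 < r := by rw [hr]; positivity
  have hr2 : q * r ^ 2 = q ^ (-(2 * ε)) := by
    rw [hr, ← Real.rpow_natCast, ← Real.rpow_mul hq0.le]
    conv_lhs => rw [← Real.rpow_one q, ← Real.rpow_mul hq0.le, ← Real.rpow_add hq0]
    congr 1; push_cast; ring
  have hρ0 : 0 < ρ := by rw [hρ]; positivity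
  have hρ1 : ρ < 1 := by
    rw [hρ]; exact Real.rpow_lt_one_of_one_lt_of_neg (by norm_num) (by linarith)
  have hqρ : ∀ s, ε / 4 ≤ s → q ^ (-s) ≤ ρ := by
    intro s hs
    rw [hρ]
    calc q ^ (-s) ≤ q ^ (-(ε / 4)) :=
          Real.rpow_le_rpow_of_exponent_le (by linarith) (by linarith)
      _ ≤ _ := Real.rpow_le_rpow_of_nonpos (by norm_num) hq3 (by linarith)
  have hqr : q * r ^ 2 ≤ ρ := by rw [hr2]; exact hqρ _ (by linarith)
  have hr3 : r ^ 2 ≤ 1 / 3 := by nlinarith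
  have hr1 : r < 1 := by nlinarith
  have hrk : ∀ k : ℕ, r ^ k = (q ^ k) ^ (-(1 / 2 : ℝ) - ε) := by
    intro k
    rw [hr, ← Real.rpow_natCast, ← Real.rpow_natCast q, ← Real.rpow_mul hq0.le,
      ← Real.rpow_mul hq0.le, mul_comm]
  have hQ : ∀ (k : ℕ) (s : ℝ), ε / 4 ≤ s → (q ^ k) ^ (-s) ≤ ρ ^ k := by
    intro k s hs
    rw [← Real.rpow_natCast, ← Real.rpow_mul hq0.le, mul_comm, Real.rpow_mul hq0.le,
      Real.rpow_natCast]
    exact pow_le_pow_left₀ (by positivity) (hqρ s hs) k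
  have hA : ∀ k : ℕ, min (8 * d * Real.sqrt (q ^ k)) (q ^ k) * r ^ k ≤
      8 * d ^ (1 - 3 * ε / 2) * ρ ^ k := by
    intro k
    have hQ0 : 0 < q ^ k := by positivity
    -- The powers of `Q = q ^ k` combine to `Q ^ (-ε / 4)`.
    have h1 := min_le_rpow_mul_rpow (x := 8 * d * Real.sqrt (q ^ k)) (y := q ^ k)
      (θ := 1 - 3 * ε / 2) (by positivity) hQ0 (by linarith) (by linarith)
    have h8 : (8 : ℝ) ^ (1 - 3 * ε / 2) ≤ 8 := by
      conv_rhs => rw [← Real.rpow_one 8]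
      exact Real.rpow_le_rpow_of_exponent_le (by norm_num) (by linarith)
    have h2 := hQ k (ε / 4) le_rfl
    rw [hrk]
    generalize q ^ k = Q at *
    calc min (8 * d * Real.sqrt Q) Q * Q ^ (-(1 / 2 : ℝ) - ε)
        ≤ ((8 * d * Real.sqrt Q) ^ (1 - 3 * ε / 2) * Q ^ (1 - (1 - 3 * ε / 2))) *
          Q ^ (-(1 / 2 : ℝ) - ε) := by gcongr
      _ = 8 ^ (1 - 3 * ε / 2) * d ^ (1 - 3 * ε / 2) * Q ^ (-(ε / 4)) := by
          rw [Real.mul_rpow (by positivity) (by positivity),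
            Real.mul_rpow (by positivity) (by positivity), Real.sqrt_eq_rpow,
            ← Real.rpow_mul hQ0.le]
          rw [mul_assoc, mul_assoc (_ * _), ← Real.rpow_add hQ0, ← Real.rpow_add hQ0]
          congr 2; ring
      _ ≤ 8 * d ^ (1 - 3 * ε / 2) * ρ ^ k := by gcongr
  have hC : ∀ k : ℕ, Real.sqrt (q ^ k) * r ^ k ≤ ρ ^ k := by
    intro k
    have hQ0 : 0 < q ^ k := by positivity
    rw [hrk, Real.sqrt_eq_rpow, ← Real.rpow_add hQ0]
    refine le_trans (le_of_eq ?_) (hQ k ε (by linarith))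
    congr 1; ring
  have hrec : ∀ n : ℕ, (n : ℝ) * (charSum (f * g ^ 2) n : ℝ) = ∑ k ∈ Finset.range n,
      (primePowerSum (f * g ^ 2) (k + 1) : ℝ) * (charSum (f * g ^ 2) (n - (k + 1)) : ℝ) := by
    intro n
    have h := congrArg (Int.cast : ℤ → ℝ) (natCast_mul_charSum (f * g ^ 2) n)
    push_cast at h
    exact h
  have hmain := abs_mul_pow_le_exp_of_recursion (fun n => (charSum (f * g ^ 2) n : ℝ))
    (fun k => (primePowerSum (f * g ^ 2) k : ℝ))
    (fun k => min (8 * d * Real.sqrt (q ^ k)) (q ^ k) +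
      (∑ P ∈ primeDivisors g, if P.natDegree ∣ k then (P.natDegree : ℝ) else 0) +
        2 * Real.sqrt (q ^ k)) r hr0.le (by simp [charSum_zero])
    hrec
    (fun k => abs_primePowerSum_le hq f g hf hd hg (k + 1) (Nat.succ_ne_zero k)) n
  refine hmain.trans ?_
  have hpos : ∀ P : F[X], 0 < 1 + r ^ P.natDegree := fun P => by positivity
  rw [← Real.exp_log (Finset.prod_pos fun P (_ : P ∈ primeDivisors g) => hpos P), ← Real.exp_add,
    Real.exp_le_exp, Real.log_prod fun P _ => (hpos P).ne']
  have hsum : ∑ k ∈ Finset.range n, (min (8 * d * Real.sqrt (q ^ (k + 1))) (q ^ (k + 1)) +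
      (∑ P ∈ primeDivisors g, if P.natDegree ∣ k + 1 then (P.natDegree : ℝ) else 0) +
        2 * Real.sqrt (q ^ (k + 1))) * r ^ (k + 1) / ((k : ℝ) + 1) ≤
      ∑ k ∈ Finset.range n, ((8 * d ^ (1 - 3 * ε / 2) + 2) * (ρ ^ (k + 1) / ((k : ℝ) + 1)) +
        ∑ P ∈ primeDivisors g, (if P.natDegree ∣ k + 1 then (P.natDegree : ℝ) else 0) *
          r ^ (k + 1) / ((k : ℝ) + 1)) := by
    refine Finset.sum_le_sum fun k _ => ?_
    rw [← Finset.sum_div, ← Finset.sum_mul, ← mul_div_assoc, ← add_div]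
    refine div_le_div_of_nonneg_right ?_ (by positivity)
    have := hA (k + 1)
    have := hC (k + 1)
    nlinarith
  refine hsum.trans ?_
  rw [Finset.sum_add_distrib, ← Finset.mul_sum, Finset.sum_comm]
  have hB : ∑ P ∈ primeDivisors g, ∑ k ∈ Finset.range n,
      (if P.natDegree ∣ k + 1 then (P.natDegree : ℝ) else 0) * r ^ (k + 1) / ((k : ℝ) + 1) ≤
      ∑ P ∈ primeDivisors g, (Real.log (1 + r ^ P.natDegree) + 2 * (r ^ P.natDegree) ^ 2) := by
    refine Finset.sum_le_sum fun P hP => ?_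
    have hP0 := ((mem_primeDivisors hg).1 hP).2.1.natDegree_pos
    refine (sum_dvd_pow_div_le hr0.le hr1 hP0 n).trans (neg_log_one_sub_le (by positivity) ?_)
    have : r ^ P.natDegree ≤ r := pow_le_of_le_one hr0.le hr1.le hP0.ne'
    have : 0 ≤ r ^ P.natDegree := by positivity
    nlinarith
  rw [Finset.sum_add_distrib, ← Finset.mul_sum] at hB
  have hS := sum_primeDivisors_le hρ0.le hρ1 hqr hg
  have hG := sum_pow_succ_div_le hρ0.le hρ1 n
  have hD : 0 ≤ 8 * d ^ (1 - 3 * ε / 2) + 2 := by positivity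
  have := mul_le_mul_of_nonneg_left hG hD
  linarith

end Analysis

end FunctionFieldCharSum

theorem lemma2p2 (ε : ℝ) (hε : 0 < ε) :
    ∃ K : ℝ, ∀ (F : Type u) [Field F] [Fintype F], Odd (Fintype.card F) →
      ∀ (n : ℕ) (ℓ ℓ₁ ℓ₂ : F[X]), ℓ = ℓ₁ * ℓ₂ ^ 2 → Squarefree ℓ₁ →
        (∀ (c : F) (g : F[X]), ℓ ≠ Polynomial.C c * g ^ 2) →
        |((∑ D ∈ FunctionFieldCharSum.hyperelliptic F n, FunctionFieldCharSum.chi D ℓ : ℤ) : ℝ)| ≤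
          K * (Fintype.card F : ℝ) ^ ((1 / 2 + ε) * (n : ℝ)) *
            Real.exp ((ℓ₁.natDegree : ℝ) ^ (1 - ε)) *
            ∏ P ∈ FunctionFieldCharSum.primeDivisors ℓ₂,
              (1 + FunctionFieldCharSum.polyNorm P ^ (-(1 / 2 : ℝ) - ε)) := by
  classical
  have hnorm : ∀ (F : Type u) [Field F] [Fintype F] (P : F[X]),
      0 ≤ FunctionFieldCharSum.polyNorm P := by
    intro F _ _ P
    unfold FunctionFieldCharSum.polyNorm
    split_ifs <;> positivity
  rcases le_or_gt (1 / 2) ε with hε1 | hε1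
  · refine ⟨1, ?_⟩
    intro F _ _ hq n ℓ ℓ₁ ℓ₂ _ _ _
    have hq3 : (3 : ℝ) ≤ Fintype.card F := by
      exact_mod_cast FunctionFieldCharSum.three_le_card hq
    have h1 : |((FunctionFieldCharSum.charSum ℓ n : ℤ) : ℝ)| ≤ (Fintype.card F : ℝ) ^ n := by
      exact_mod_cast FunctionFieldCharSum.abs_charSum_le ℓ n
    have h2 : (Fintype.card F : ℝ) ^ n ≤ (Fintype.card F : ℝ) ^ ((1 / 2 + ε) * (n : ℝ)) := by
      rw [← Real.rpow_natCast]
      refine Real.rpow_le_rpow_of_exponent_le (by linarith) ?_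
      have : (0 : ℝ) ≤ n := by positivity
      nlinarith
    have h3 : 1 ≤ Real.exp ((ℓ₁.natDegree : ℝ) ^ (1 - ε)) := Real.one_le_exp (by positivity)
    have h4 : 1 ≤ ∏ P ∈ FunctionFieldCharSum.primeDivisors ℓ₂,
        (1 + FunctionFieldCharSum.polyNorm P ^ (-(1 / 2 : ℝ) - ε)) := by
      refine Finset.prod_const_one.symm.le.trans
        (Finset.prod_le_prod (fun _ _ => zero_le_one) fun P _ => ?_)
      have := Real.rpow_nonneg (hnorm F P) (-(1 / 2 : ℝ) - ε)
      linarith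
    refine (h1.trans h2).trans ?_
    rw [one_mul, mul_assoc]
    exact le_mul_of_one_le_right (by positivity) (one_le_mul_of_one_le_of_one_le h3 h4)
  · obtain ⟨ρ, hρ⟩ : ∃ ρ, ρ = (3 : ℝ) ^ (-(ε / 4)) := ⟨_, rfl⟩
    have hρ0 : 0 < ρ := by rw [hρ]; positivity
    have hρ1 : ρ < 1 := by
      rw [hρ]; exact Real.rpow_lt_one_of_one_lt_of_neg (by norm_num) (by linarith)
    have hc : 1 ≤ 8 * (1 - ρ)⁻¹ := by
      have := (one_le_inv₀ (show 0 < 1 - ρ by linarith)).2 (by linarith)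
      linarith
    obtain ⟨B, hB⟩ := FunctionFieldCharSum.exists_const_mul_rpow_le _ ε hc hε hε1
    refine ⟨Real.exp (B + 4 * (1 - ρ)⁻¹), ?_⟩
    intro F _ _ hq n ℓ ℓ₁ ℓ₂ hℓ hsf hns
    have hq0 : (0 : ℝ) < Fintype.card F := by exact_mod_cast Fintype.card_pos
    -- That `ℓ` is not a constant times a square excludes `ℓ₂ = 0` and a constant `ℓ₁`.
    have hg : ℓ₂ ≠ 0 := by
      rintro rfl
      exact hns 0 0 (by rw [hℓ]; simp)
    have hd : 0 < ℓ₁.natDegree := by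
      by_contra h
      have h0 := Polynomial.eq_C_of_natDegree_eq_zero (Nat.eq_zero_of_not_pos h)
      exact hns (ℓ₁.coeff 0) ℓ₂ (by rw [hℓ, ← h0])
    obtain ⟨r, hr⟩ : ∃ r, r = (Fintype.card F : ℝ) ^ (-(1 / 2 : ℝ) - ε) := ⟨_, rfl⟩
    have hr0 : 0 < r := by rw [hr]; positivity
    have hmain := FunctionFieldCharSum.abs_charSum_mul_pow_le
      ε hε hε1 hq ℓ₁ ℓ₂ hsf hd hg n r ρ hr hρ
    have hprod : ∏ P ∈ FunctionFieldCharSum.primeDivisors ℓ₂,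
        (1 + FunctionFieldCharSum.polyNorm P ^ (-(1 / 2 : ℝ) - ε)) =
        ∏ P ∈ FunctionFieldCharSum.primeDivisors ℓ₂, (1 + r ^ P.natDegree) := by
      refine Finset.prod_congr rfl fun P hP => ?_
      have hP0 := ((FunctionFieldCharSum.mem_primeDivisors hg).1 hP).2.1.ne_zero
      rw [FunctionFieldCharSum.polyNorm, if_neg hP0, hr, ← Real.rpow_natCast,
        ← Real.rpow_natCast, ← Real.rpow_mul hq0.le, ← Real.rpow_mul hq0.le, mul_comm]
    have hrn : (Fintype.card F : ℝ) ^ ((1 / 2 + ε) * (n : ℝ)) = (r ^ n)⁻¹ := by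
      rw [hr, ← Real.rpow_natCast, ← Real.rpow_mul hq0.le, ← Real.rpow_neg hq0.le]
      congr 1; ring
    rw [hprod, hrn]
    have hexp : Real.exp (8 * (1 - ρ)⁻¹ * (ℓ₁.natDegree : ℝ) ^ (1 - 3 * ε / 2) + 4 * (1 - ρ)⁻¹) ≤
        Real.exp (B + 4 * (1 - ρ)⁻¹) * Real.exp ((ℓ₁.natDegree : ℝ) ^ (1 - ε)) := by
      rw [← Real.exp_add, Real.exp_le_exp]
      have := hB ℓ₁.natDegree (by exact_mod_cast hd)
      linarith
    have hfin : |(FunctionFieldCharSum.charSum (ℓ₁ * ℓ₂ ^ 2) n : ℝ)| * r ^ n ≤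
        Real.exp (B + 4 * (1 - ρ)⁻¹) * Real.exp ((ℓ₁.natDegree : ℝ) ^ (1 - ε)) *
          ∏ P ∈ FunctionFieldCharSum.primeDivisors ℓ₂, (1 + r ^ P.natDegree) :=
      hmain.trans (mul_le_mul_of_nonneg_right hexp
        (Finset.prod_nonneg fun P _ => by positivity))
    rw [hℓ]
    change |(FunctionFieldCharSum.charSum (ℓ₁ * ℓ₂ ^ 2) n : ℝ)| ≤ _
    rw [← le_div_iff₀ (by positivity)] at hfin
    refine hfin.trans (le_of_eq ?_)
    rw [div_eq_mul_inv]
    ring
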